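/- Let $\underline k\le\bar k$ and $\underline u<\bar u$ be real numbers. Let $k\in(\mathrm{BV}\cap\mathrm L^\infty)(\mathbb R)$ with $k(x)\in[\underline k,\bar k]$ for a.e. $x$, and let $u_0\in(\mathrm L^\infty\cap\mathrm{BV})(\mathbb R)$ with $u_0(x)\in[\underline u,\bar u]$ for a.e. $x$, where $\mathrm{BV}(\mathbb R)$ means finite (essential) total variation. Put $C_{u_0}:=\max\{|\underline u|,|\bar u|\}$. Let $f=f(k,u)$ be a real function on $[\underline k,\bar k]\times[\underline u,\bar u]$ such that: for each $k$, $f(k,\cdot)\in C^3[\underline u,\bar u]$ is strictly convex, and there are constants $\gamma_1,\gamma_2$ with $0<\gamma_1\le f_{uu}(k,u)\le\gamma_2$ for all $(k,u)$; for each $u$, $f(\cdot,u)\in C^2[\underline k,\bar k]$ with $\partial^2_{kk}f\equiv0$, and $f_u(\cdot,u)\in C^1[\underline k,\bar k]$; and $f(k_1,\bar u)=f(k_2,\bar u)$, $f(k_1,\underline u)=f(k_2,\underline u)$ for all $k_1,k_2\in[\underline k,\bar k]$. Fix $\lambda>0$. For $\Delta x>0$ put $\Delta t=\lambda\Delta x$,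 $x_j=j\Delta x$ for $j\in\frac12\mathbb Z$, $k_j=\frac1{\Delta x}\int_{x_{j-1/2}}^{x_{j+1/2}}k(x)\,dx$ for $j\in\frac12\mathbb Z$, and $u_j^0=\frac1{\Delta x}\int_{x_{j-1/2}}^{x_{j+1/2}}u_0(x)\,dx$ for $j\in\mathbb Z$. For $n\ge0$ and $j+\frac n2\in\mathbb Z$ define $$\sigma_j^n=\operatorname{minmod}\bigl(u_{j+1}^n-u_j^n,\ \tfrac12(u_{j+1}^n-u_{j-1}^n),\ u_j^n-u_{j-1}^n\bigr),\qquad u_j^{n+1/2}=u_j^n-\tfrac\lambda2 f_u(k_j,u_j^n)\,\sigma_j^n,$$ $$u_{j+1/2}^{n+1}=\tfrac12(u_j^n+u_{j+1}^n)-\tfrac18(\sigma_{j+1}^n-\sigma_j^n)-\lambda\bigl(f(k_{j+1},u_{j+1}^{n+1/2})-f(k_j,u_j^{n+1/2})\bigr),$$ where $\operatorname{minmod}(a_1,a_2,a_3)=\operatorname{sgn}(a_1)\min_i|a_i|$ if $a_1,a_2,a_3$ all have the same sign, and $0$ otherwise. Assume that, for some real $\kappa$, the CFL condition $$\lambda\|f_u\|_\infty\le\kappa\le\min\Bigl\{\frac{\gamma_1}{7500\,\gamma_2},\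 \frac1{4000},\ \frac7{85+16C_{u_0}},\ \frac{\gamma_1}{\gamma_2\chi}\Bigr\},\qquad \chi:=228+13C_{u_0}+174\,C_{u_0}\gamma_2+12\,C_{u_0}^2\gamma_2,$$ holds, where $\|f_u\|_\infty$ is the supremum of $|f_u|$ over $[\underline k,\bar k]\times[\underline u,\bar u]$. Let $T,X>0$, and put $N:=\lfloor T/\Delta t\rfloor+1$ and $J:=\lfloor X/\Delta x\rfloor+1$. Then for every $\Delta x_0>0$ there is a constant $C(X,T)$, independent of $\Delta x$, such that for all $0<\Delta x\le\Delta x_0$ $$\Delta x\sum_{n=0}^{N-1}\ \sum_{\substack{|j|\le J\\ j+\frac n2\in\mathbb Z}}\bigl|u_{j+1}^n-u_j^n\bigr|^3\le C(X,T).$$ -/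

import Mathlib

open MeasureTheory

noncomputable section

namespace CentralScheme

/-- `g ∈ (L^∞ ∩ BV)(ℝ)`: `g` is measurable, essentially bounded, and its essential total variation
is finite, i.e. some function in its almost-everywhere class has finite total variation on `ℝ`. -/
def MemLinftyBV (g : ℝ → ℝ) : Prop :=
  MemLp g ⊤ volume ∧ ∃ v : ℝ → ℝ, g =ᵐ[volume] v ∧ BoundedVariationOn v Set.univ

/-- `f_u(k, u)`, the derivative with respect to the state `u ∈ [ulo, uhi]`
(one-sided at the end points). -/
def fluxDu (f : ℝ → ℝ → ℝ) (ulo uhi k u : ℝ) : ℝ :=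
  derivWithin (f k) (Set.Icc ulo uhi) u

/-- `f_{uu}(k, u)`, the second derivative with respect to the state `u ∈ [ulo, uhi]`. -/
def fluxDuu (f : ℝ → ℝ → ℝ) (ulo uhi k u : ℝ) : ℝ :=
  iteratedDerivWithin 2 (f k) (Set.Icc ulo uhi) u

/-- The assumptions on the flux `f : (k, u) ↦ f k u` on `[klo, khi] × [ulo, uhi]`. The values of `f`
outside this rectangle are irrelevant. -/
structure FluxHypotheses (f : ℝ → ℝ → ℝ) (klo khi ulo uhi γ₁ γ₂ : ℝ) : Prop where
  contDiffOn_u : ∀ k ∈ Set.Icc klo khi, ContDiffOn ℝ 3 (f k) (Set.Icc ulo uhi)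
  strictConvexOn_u : ∀ k ∈ Set.Icc klo khi, StrictConvexOn ℝ (Set.Icc ulo uhi) (f k)
  gamma_pos : 0 < γ₁
  fuu_ge : ∀ k ∈ Set.Icc klo khi, ∀ u ∈ Set.Icc ulo uhi, γ₁ ≤ fluxDuu f ulo uhi k u
  fuu_le : ∀ k ∈ Set.Icc klo khi, ∀ u ∈ Set.Icc ulo uhi, fluxDuu f ulo uhi k u ≤ γ₂
  contDiffOn_k : ∀ u ∈ Set.Icc ulo uhi, ContDiffOn ℝ 2 (fun k => f k u) (Set.Icc klo khi)
  fkk_eq_zero : ∀ u ∈ Set.Icc ulo uhi, ∀ k ∈ Set.Icc klo khi,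
    iteratedDerivWithin 2 (fun k => f k u) (Set.Icc klo khi) k = 0
  contDiffOn_fu_k : ∀ u ∈ Set.Icc ulo uhi,
    ContDiffOn ℝ 1 (fun k => fluxDu f ulo uhi k u) (Set.Icc klo khi)
  eq_at_top : ∀ k₁ ∈ Set.Icc klo khi, ∀ k₂ ∈ Set.Icc klo khi, f k₁ uhi = f k₂ uhi
  eq_at_bot : ∀ k₁ ∈ Set.Icc klo khi, ∀ k₂ ∈ Set.Icc klo khi, f k₁ ulo = f k₂ ulo

/-- The minmod function of three arguments. -/
def minmod (a b c : ℝ) : ℝ :=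
  if Real.sign a = Real.sign b ∧ Real.sign b = Real.sign c then
    Real.sign a * min |a| (min |b| |c|)
  else 0

/-! Grid functions are indexed by half-integer positions: the index `m : ℤ` stands for the point
`x_{m/2} = (m/2) Δx`. Neighbouring cells of one time level have indices `m` and `m + 2`, and the
staggered cell between them has index `m + 1`. -/

/-- Average of `g` over the cell of length `Δx` centred at `x_{m/2}`. -/
def cellAverage (g : ℝ → ℝ) (Δx : ℝ) (m : ℤ) : ℝ :=
  (1 / Δx) * ∫ x in (((m : ℝ) - 1) / 2 * Δx)..(((m : ℝ) + 1) / 2 * Δx), g x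

/-- The limited slope `σ` in the cell `m`. -/
def slope (v : ℤ → ℝ) (m : ℤ) : ℝ :=
  minmod (v (m + 2) - v m) ((1 / 2) * (v (m + 2) - v (m - 2))) (v m - v (m - 2))

/-- The mid-time value `u - (λ/2) f_u(k, u) σ` in the cell `m`; here `lam = Δt / Δx`. -/
def midValue (f : ℝ → ℝ → ℝ) (ulo uhi lam : ℝ) (κd v : ℤ → ℝ) (m : ℤ) : ℝ :=
  v m - lam / 2 * fluxDu f ulo uhi (κd m) (v m) * slope v m

/-- One time step of the staggered second-order scheme: the new value in the cell `m` from the old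
values in the cells `m - 1` and `m + 1` (and their slopes). -/
def step (f : ℝ → ℝ → ℝ) (ulo uhi lam : ℝ) (κd v : ℤ → ℝ) (m : ℤ) : ℝ :=
  (1 / 2) * (v (m - 1) + v (m + 1)) - (1 / 8) * (slope v (m + 1) - slope v (m - 1))
    - lam * (f (κd (m + 1)) (midValue f ulo uhi lam κd v (m + 1))
        - f (κd (m - 1)) (midValue f ulo uhi lam κd v (m - 1)))

/-- The approximate solution: `approx … n m` is `u^n_{m/2}`. At time level `n` the cells of the
scheme are those with `m + n` even; a step to such a cell only uses such cells of level `n - 1`, and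
the other values never enter. -/
def approx (f : ℝ → ℝ → ℝ) (ulo uhi lam : ℝ) (k u₀ : ℝ → ℝ) (Δx : ℝ) : ℕ → ℤ → ℝ
  | 0 => cellAverage u₀ Δx
  | n + 1 => step f ulo uhi lam (cellAverage k Δx) (approx f ulo uhi lam k u₀ Δx n)

/-- `C_{u₀} = max(|ulo|, |uhi|)`. -/
def boundC (ulo uhi : ℝ) : ℝ := max |ulo| |uhi|

/-- The constant `χ` of the CFL condition, with `c = C_{u₀}`. -/
def chi (c γ₂ : ℝ) : ℝ := 228 + 13 * c + 174 * c * γ₂ + 12 * c ^ 2 * γ₂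

/-- The CFL condition
`λ ‖f_u‖ ≤ κ ≤ min {γ₁/(7500 γ₂), 1/4000, 7/(85 + 16 C_{u₀}), γ₁/(γ₂ χ)}`,
with the supremum norm over `[klo, khi] × [ulo, uhi]` written out pointwise. -/
def CFL (f : ℝ → ℝ → ℝ) (klo khi ulo uhi γ₁ γ₂ lam κ : ℝ) : Prop :=
  (∀ k ∈ Set.Icc klo khi, ∀ u ∈ Set.Icc ulo uhi, lam * |fluxDu f ulo uhi k u| ≤ κ) ∧
  κ ≤ min (min (γ₁ / (7500 * γ₂)) (1 / 4000))
        (min (7 / (85 + 16 * boundC ulo uhi)) (γ₁ / (γ₂ * chi (boundC ulo uhi) γ₂)))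

/-- `∑_{n=0}^{N-1} ∑_{|j| ≤ J, j + n/2 ∈ ℤ} |u^n_{j+1} - u^n_j|³`, with `j = m/2`. -/
def cubicSum (u : ℕ → ℤ → ℝ) (N J : ℕ) : ℝ :=
  ∑ n ∈ Finset.range N,
    ∑ m ∈ (Finset.Icc (-(2 * (J : ℤ))) (2 * (J : ℤ))).filter (fun m => Even (m + (n : ℤ))),
      |u n (m + 2) - u n m| ^ 3

end CentralScheme

end

/-!
The proof is a Lyapunov argument for `∑ u² + ∑ ((Δu)⁺)²`, where `Δu` is the jump between
neighbouring cells.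

The entropy balance for `u²` dissipates the cubes of the down-jumps, by uniform convexity of
`f(k, ·)`, but the centred flux produces entropy at the up-jumps, at most half the squared jump
times the jump of the characteristic speed. The squared up-jumps themselves decay at the full
rate, squared jump times jump of the speed, because a convex flux spreads rarefactions. In the sum
of both balances a fixed multiple of `λ γ₁ |Δu|³` is therefore lost on every edge.

The second-order corrections are of two kinds. Where neighbouring slopes differ, the limiter
dissipates, and under the CFL condition this absorbs all terms containing differences of slopes;
the remaining ones are cubic with a factor `λ ‖f_u‖ γ₂`, small against `γ₁`.

Since `f` is affine in `k`, the speed `f_u` is Lipschitz in `k`, so the errors caused by the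
variation of `k` are summable, uniformly in `Δx`, for `k` of bounded variation. In a finite window
the numerical fluxes only contribute bounded boundary terms, so that a window of `L` cells loses
at most `O(L + N)` in `N` steps, and `Δx (L + N)` is bounded.
-/

namespace CentralScheme

noncomputable section

/-! ### Numbers between zero and a jump -/

section Between

variable {d s t : ℝ}

theorem abs_le_abs_of_mem_uIcc_zero (hs : s ∈ Set.uIcc 0 d) : |s| ≤ |d| := by
  simpa only [sub_zero] using Set.abs_sub_left_of_mem_uIcc hs

theorem abs_sub_le_of_mem_uIcc_zero (hs : s ∈ Set.uIcc 0 d) (ht : t ∈ Set.uIcc 0 d) :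
    |t - s| ≤ |d| := by
  simpa only [sub_zero] using Set.abs_sub_le_of_uIcc_subset_uIcc (Set.uIcc_subset_uIcc hs ht)

theorem mul_sub_nonneg_of_mem_uIcc_zero (hs : s ∈ Set.uIcc 0 d) : 0 ≤ d * (d - s) := by
  rcases Set.mem_uIcc.1 hs with ⟨h0, hd⟩ | ⟨hd, h0⟩
  · exact mul_nonneg (h0.trans hd) (sub_nonneg.2 hd)
  · exact mul_nonneg_of_nonpos_of_nonpos (hd.trans h0) (sub_nonpos.2 hd)

theorem abs_sub_mul_abs_le_of_mem_uIcc_zero (hs : s ∈ Set.uIcc 0 d) (ht : t ∈ Set.uIcc 0 d) :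
    |t - s| * |d| ≤ d * (2 * d - s - t) := by
  have hds := mul_sub_nonneg_of_mem_uIcc_zero hs
  have hdt := mul_sub_nonneg_of_mem_uIcc_zero ht
  rw [← abs_mul]
  exact abs_le.2 ⟨by linarith, by linarith⟩

theorem posPart_mem_uIcc_zero (hs : s ∈ Set.uIcc 0 d) : s⁺ ∈ Set.uIcc 0 d⁺ := by
  have h := posPart_mono.image_uIcc_subset (Set.mem_image_of_mem _ hs)
  rwa [posPart_zero] at h

theorem posPart_mul_sub_posPart_le (hs : s ∈ Set.uIcc 0 d) : d⁺ * (d⁺ - s⁺) ≤ d * (d - s) := by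
  rcases le_total d 0 with hd | hd
  · rw [posPart_of_nonpos hd, zero_mul]
    exact mul_sub_nonneg_of_mem_uIcc_zero hs
  · rw [Set.uIcc_of_le hd] at hs
    rw [posPart_of_nonneg hd, posPart_of_nonneg hs.1]

end Between

section Real

variable {a b c x y δ M : ℝ}

theorem abs_mul_le_mul (hx : |x| ≤ a) (hy : |y| ≤ b) : |x * y| ≤ a * b := by
  rw [abs_mul]
  exact mul_le_mul hx hy (abs_nonneg y) ((abs_nonneg x).trans hx)

theorem mul_le_mul_of_abs_le (hx : |x| ≤ a) (hy : |y| ≤ b) : x * y ≤ a * b :=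
  (le_abs_self _).trans (abs_mul_le_mul hx hy)

theorem sq_sub_sq_le (hx : |x| ≤ M) (hy : |y| ≤ M) (hxy : |x - y| ≤ δ) :
    |x ^ 2 - y ^ 2| ≤ 2 * M * δ := by
  rw [sq_sub_sq]
  exact abs_mul_le_mul ((abs_add_le x y).trans (by linarith)) hxy

theorem posPart_le_abs (x : ℝ) : x⁺ ≤ |x| :=
  posPart_add_negPart x ▸ le_add_of_nonneg_right (negPart_nonneg x)

theorem mul_sq_le_cube_add_cube (ha : 0 ≤ a) (hb : 0 ≤ b) : a * b ^ 2 ≤ a ^ 3 + b ^ 3 := by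
  rcases le_total a b with h | h
  · calc a * b ^ 2 ≤ b * b ^ 2 := by gcongr
      _ = 0 + b ^ 3 := by ring
      _ ≤ a ^ 3 + b ^ 3 := by gcongr; positivity
  · calc a * b ^ 2 ≤ a * a ^ 2 := by gcongr
      _ = a ^ 3 + 0 := by ring
      _ ≤ a ^ 3 + b ^ 3 := by gcongr; positivity

theorem sq_sub_le_sq_add (h : |y - δ| ≤ M) : (y - δ) ^ 2 ≤ y ^ 2 + 2 * M * |δ| := by
  have hprod : -(M * |δ|) ≤ (y - δ) * δ := (abs_le.1 (abs_mul_le_mul h le_rfl)).1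
  nlinarith [sq_nonneg δ]

theorem sq_posPart_le_of_le_add (hxM : x ≤ M) (hM : 0 ≤ M) (hδ : 0 ≤ δ) (h : x ≤ y + δ) :
    x⁺ ^ 2 ≤ y ^ 2 + 2 * M * δ := by
  rcases le_total x 0 with hx | hx
  · rw [posPart_of_nonpos hx, zero_pow two_ne_zero]
    positivity
  · rw [posPart_of_nonneg hx]
    rcases le_total x δ with hxδ | hxδ
    · have : x * x ≤ M * δ := by gcongr
      nlinarith [sq_nonneg y, mul_nonneg hM hδ]
    · have := pow_le_pow_left₀ (sub_nonneg.2 hxδ) (sub_le_iff_le_add.2 h) 2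
      nlinarith [mul_le_mul_of_nonneg_right hxM hδ, sq_nonneg δ]

end Real

/-! ### One step of a scheme with limited slopes -/

/-- One time step of a staggered second-order scheme with limited slopes, reduced to what the
Lyapunov estimate uses. Edge `m` joins the cells `m` and `m + 2`, and the new cell on it is `m + 1`.
* `u`, `v`: the old and the new values, bounded by `U`; `σ`: the limited slopes;
* `ν m`, `μ m`, `ν' m`: characteristic speeds, times `λ`, at the left end, in the middle and at the
  right end of edge `m`, all for the flux of the cell `m`; `ℓ₁`, `ℓ₂` bound their divided
  differences from below and above;
* `r m`: the part of the numerical flux of the cell `m` coming from its slope;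
* `q`: an entropy flux, bounded by `B`;
* `ε m`: the error caused by the dependence of the flux on the cell, bounded by `e m`. -/
structure StaggeredStep (κ ℓ₁ ℓ₂ U B : ℝ) where
  (u v σ r ν ν' μ q e ε : ℤ → ℝ)
  κ_nonneg : 0 ≤ κ
  κ_le : κ ≤ 1 / 7500
  κ_mul_le : κ * ℓ₂ ≤ ℓ₁ / 7500
  ℓ₂_nonneg : 0 ≤ ℓ₂
  ℓ₂_mul_le (m : ℤ) : ℓ₂ * |u (m + 2) - u m| ≤ 1
  abs_u_le (m : ℤ) : |u m| ≤ U
  abs_v_le (m : ℤ) : |v m| ≤ U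
  σ_mem (m : ℤ) : σ m ∈ Set.uIcc 0 (u (m + 2) - u m)
  σ_succ_mem (m : ℤ) : σ (m + 2) ∈ Set.uIcc 0 (u (m + 2) - u m)
  posPart_σ_succ (m : ℤ) : (σ (m + 2))⁺ = min (u (m + 2) - u m)⁺ (u (m + 2 + 2) - u (m + 2))⁺
  abs_ν_le (m : ℤ) : |ν m| ≤ κ
  abs_ν'_le (m : ℤ) : |ν' m| ≤ κ
  abs_μ_le (m : ℤ) : |μ m| ≤ κ
  abs_r_add_le (m : ℤ) : |r m + ν m ^ 2 * σ m / 2| ≤ ℓ₂ * κ ^ 2 * σ m ^ 2 / 4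
  abs_μ_sub_ν_le (m : ℤ) : |μ m - ν m| ≤ ℓ₂ * |u (m + 2) - u m|
  abs_ν'_sub_μ_le (m : ℤ) : |ν' m - μ m| ≤ ℓ₂ * |u (m + 2) - u m|
  le_ν'_sub_ν (m : ℤ) : 0 ≤ u (m + 2) - u m → ℓ₁ * (u (m + 2) - u m) ≤ ν' m - ν m
  e_nonneg (m : ℤ) : 0 ≤ e m
  abs_ν_succ_sub_ν'_le (m : ℤ) : |ν (m + 2) - ν' m| ≤ e m
  abs_ε_le (m : ℤ) : |ε m| ≤ e m
  abs_q_le (m : ℤ) : |q m| ≤ B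
  entropy_le (m : ℤ) : -((u m + u (m + 2)) * (μ m * (u (m + 2) - u m))) ≤
    q m - q (m + 2) + ((u (m + 2) - u m)⁺ ^ 2 * (ν' m - ν m) / 2
      - ℓ₁ / 6 * (u (m + 2) - u m)⁻ ^ 3) + e m
  v_eq (m : ℤ) : v (m + 1) = (u m + u (m + 2)) / 2 - (σ (m + 2) - σ m) / 8
    - (μ m * (u (m + 2) - u m) + (r (m + 2) - r m)) - ε m

namespace StaggeredStep

variable {κ ℓ₁ ℓ₂ U B : ℝ} (S : StaggeredStep κ ℓ₁ ℓ₂ U B) (m : ℤ)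

/-- The jump of the old values across edge `m`. -/
def d : ℝ := S.u (m + 2) - S.u m

/-- The jump of the slope fluxes `r` across edge `m`. -/
def g : ℝ := S.r (m + 2) - S.r m

/-- The dissipation caused by the limitation of the slopes at the two ends of edge `m`. -/
def Z : ℝ := S.d m * (2 * S.d m - S.σ m - S.σ (m + 2))

theorem U_nonneg (S : StaggeredStep κ ℓ₁ ℓ₂ U B) : 0 ≤ U := (abs_nonneg _).trans (S.abs_u_le 0)

theorem abs_d_le : |S.d m| ≤ 2 * U :=
  (abs_sub _ _).trans (by linarith [S.abs_u_le m, S.abs_u_le (m + 2)])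

theorem sq_d_le : S.d m ^ 2 ≤ 4 * U ^ 2 := by
  calc S.d m ^ 2 ≤ (2 * U) ^ 2 := sq_le_sq' (abs_le.1 (S.abs_d_le m)).1 (abs_le.1 (S.abs_d_le m)).2
    _ = 4 * U ^ 2 := by ring

theorem abs_σ_le : |S.σ m| ≤ |S.d m| := abs_le_abs_of_mem_uIcc_zero (S.σ_mem m)

theorem abs_σ_succ_le : |S.σ (m + 2)| ≤ |S.d m| := abs_le_abs_of_mem_uIcc_zero (S.σ_succ_mem m)

theorem abs_σ_sub_mul_le_Z : |S.σ (m + 2) - S.σ m| * |S.d m| ≤ S.Z m :=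
  abs_sub_mul_abs_le_of_mem_uIcc_zero (S.σ_mem m) (S.σ_succ_mem m)

theorem Z_nonneg : 0 ≤ S.Z m :=
  (mul_nonneg (abs_nonneg _) (abs_nonneg _)).trans (S.abs_σ_sub_mul_le_Z m)

theorem sq_σ_sub_le_Z : (S.σ (m + 2) - S.σ m) ^ 2 ≤ S.Z m := by
  calc (S.σ (m + 2) - S.σ m) ^ 2 = |S.σ (m + 2) - S.σ m| * |S.σ (m + 2) - S.σ m| := by
        rw [abs_mul_abs_self, sq]
    _ ≤ |S.σ (m + 2) - S.σ m| * |S.d m| :=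
        mul_le_mul_of_nonneg_left (abs_sub_le_of_mem_uIcc_zero (S.σ_mem m) (S.σ_succ_mem m))
          (abs_nonneg _)
    _ ≤ S.Z m := S.abs_σ_sub_mul_le_Z m

theorem sq_κ_le (S : StaggeredStep κ ℓ₁ ℓ₂ U B) : κ ^ 2 ≤ κ / 7500 := by
  nlinarith [mul_le_mul_of_nonneg_left S.κ_le S.κ_nonneg]

theorem abs_μ_sub_ν_succ_le : |S.μ m - S.ν (m + 2)| ≤ ℓ₂ * |S.d m| + S.e m := by
  rw [abs_sub_comm]
  exact (abs_sub_le _ (S.ν' m) _).trans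
    ((add_le_add (S.abs_ν_succ_sub_ν'_le m) (S.abs_ν'_sub_μ_le m)).trans_eq (add_comm _ _))

variable {m} in
theorem abs_r_add_le_of_abs_σ_le {x : ℝ} (hσ : |S.σ m| ≤ x) :
    |S.r m + S.ν m ^ 2 * S.σ m / 2| ≤ ℓ₂ * κ ^ 2 * x ^ 2 / 4 := by
  have hsq : S.σ m ^ 2 ≤ x ^ 2 := sq_le_sq' (neg_le_of_abs_le hσ) (le_of_abs_le hσ)
  have := S.ℓ₂_nonneg
  exact (S.abs_r_add_le m).trans (by gcongr)

theorem sq_ν_le : S.ν m ^ 2 ≤ κ ^ 2 :=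
  sq_le_sq' (neg_le_of_abs_le (S.abs_ν_le m)) (le_of_abs_le (S.abs_ν_le m))

variable {m} in
theorem abs_r_le_of_abs_σ_le {x : ℝ} (hσ : |S.σ m| ≤ x) (hx : ℓ₂ * x ≤ 1) :
    |S.r m| ≤ κ ^ 2 * x := by
  have hx0 : 0 ≤ x := (abs_nonneg _).trans hσ
  have hrest : |S.r m + S.ν m ^ 2 * S.σ m / 2| ≤ κ ^ 2 * x / 4 :=
    calc |S.r m + S.ν m ^ 2 * S.σ m / 2| ≤ ℓ₂ * κ ^ 2 * x ^ 2 / 4 := S.abs_r_add_le_of_abs_σ_le hσ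
      _ = ℓ₂ * x * (κ ^ 2 * x) / 4 := by ring
      _ ≤ 1 * (κ ^ 2 * x) / 4 := by gcongr
      _ = κ ^ 2 * x / 4 := by ring
  have hquad : |S.ν m ^ 2 * S.σ m| ≤ κ ^ 2 * x :=
    abs_mul_le_mul ((abs_of_nonneg (sq_nonneg _)).trans_le (S.sq_ν_le m)) hσ
  rw [abs_le] at hrest hquad ⊢
  constructor <;> linarith

theorem abs_r_succ_le : |S.r (m + 2)| ≤ κ ^ 2 * |S.d m| :=
  S.abs_r_le_of_abs_σ_le (S.abs_σ_succ_le m) (S.ℓ₂_mul_le m)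

theorem abs_g_le : |S.g m| ≤ κ * |S.d m| := by
  have h₀ := S.abs_r_le_of_abs_σ_le (S.abs_σ_le m) (S.ℓ₂_mul_le m)
  have hsq := mul_le_mul_of_nonneg_right S.sq_κ_le (abs_nonneg (S.d m))
  have := mul_nonneg S.κ_nonneg (abs_nonneg (S.d m))
  exact (abs_sub _ _).trans (by linarith [S.abs_r_succ_le m])

theorem abs_g_le_of_variation : |S.g m| ≤
    κ ^ 2 / 2 * |S.σ (m + 2) - S.σ m| + 3 * κ * ℓ₂ * S.d m ^ 2 + κ * S.e m * |S.d m| := by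
  have hκ := S.κ_nonneg
  have hℓ := S.ℓ₂_nonneg
  have hrest₀ := S.abs_r_add_le_of_abs_σ_le (S.abs_σ_le m)
  have hrest₁ := S.abs_r_add_le_of_abs_σ_le (S.abs_σ_succ_le m)
  have hν : |S.ν (m + 2) - S.ν m| ≤ 2 * ℓ₂ * |S.d m| + S.e m := by
    have h : |S.μ m - S.ν m| ≤ ℓ₂ * |S.d m| := S.abs_μ_sub_ν_le m
    refine (abs_sub_le _ (S.μ m) _).trans ?_
    rw [abs_sub_comm]
    linarith [S.abs_μ_sub_ν_succ_le m]
  have hslope : |S.ν (m + 2) ^ 2 * (S.σ (m + 2) - S.σ m)| ≤ κ ^ 2 * |S.σ (m + 2) - S.σ m| :=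
    abs_mul_le_mul ((abs_of_nonneg (sq_nonneg _)).trans_le (S.sq_ν_le _)) le_rfl
  have hspeed := abs_mul_le_mul (sq_sub_sq_le (S.abs_ν_le (m + 2)) (S.abs_ν_le m) hν) (S.abs_σ_le m)
  have hsmall : ℓ₂ * κ ^ 2 * S.d m ^ 2 ≤ κ * ℓ₂ * S.d m ^ 2 := by
    have : κ ^ 2 ≤ κ := by linarith [S.sq_κ_le]
    rw [mul_comm κ]
    gcongr
  have hsplit : 2 * κ * (2 * ℓ₂ * |S.d m| + S.e m) * |S.d m| =
      4 * (κ * ℓ₂ * S.d m ^ 2) + 2 * (κ * S.e m * |S.d m|) := by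
    rw [← sq_abs (S.d m)]
    ring
  have hnonneg : 0 ≤ κ * ℓ₂ * S.d m ^ 2 := by positivity
  rw [sq_abs] at hrest₀ hrest₁
  rw [hsplit] at hspeed
  rw [abs_le] at hrest₀ hrest₁ hslope hspeed ⊢
  unfold g
  constructor <;> linarith

/-! ### Entropy balance on an edge -/

theorem σ_sub_mul_le_Z :
    (S.σ (m + 2) - S.σ m) / 4 * (S.μ m * S.d m + S.g m) ≤ κ / 2 * S.Z m := by
  have hflux : |S.μ m * S.d m + S.g m| ≤ 2 * κ * |S.d m| :=
    (abs_add_le _ _).trans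
      (by linarith [abs_mul_le_mul (S.abs_μ_le m) (le_refl |S.d m|), S.abs_g_le m])
  have hκ := S.κ_nonneg
  calc (S.σ (m + 2) - S.σ m) / 4 * (S.μ m * S.d m + S.g m)
      = (S.σ (m + 2) - S.σ m) * (S.μ m * S.d m + S.g m) / 4 := by ring
    _ ≤ |S.σ (m + 2) - S.σ m| * (2 * κ * |S.d m|) / 4 :=
        div_le_div_of_nonneg_right (mul_le_mul_of_abs_le le_rfl hflux) (by norm_num)
    _ = κ / 2 * (|S.σ (m + 2) - S.σ m| * |S.d m|) := by ring
    _ ≤ κ / 2 * S.Z m := by gcongr; exact S.abs_σ_sub_mul_le_Z m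

theorem d_mul_r_add_sq_le {ν σ r : ℝ} (hν : |ν| ≤ κ) (hσ : σ ∈ Set.uIcc 0 (S.d m))
    (hr : |r + ν ^ 2 * σ / 2| ≤ ℓ₂ * κ ^ 2 * |S.d m| ^ 2 / 4) :
    ν ^ 2 * S.d m ^ 2 / 2 + S.d m * r ≤
      κ ^ 2 / 2 * (S.d m * (S.d m - σ)) + κ ^ 2 / 4 * (ℓ₂ * |S.d m| ^ 3) := by
  have hν2 : ν ^ 2 ≤ κ ^ 2 := sq_le_sq' (neg_le_of_abs_le hν) (le_of_abs_le hν)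
  have hlim := mul_le_mul_of_nonneg_right hν2 (mul_sub_nonneg_of_mem_uIcc_zero hσ)
  have hrest := mul_le_mul_of_abs_le (le_refl |S.d m|) hr
  linarith

/-- Lax–Wendroff cancellation: `r` is `-ν² σ / 2` up to higher order and `σ` is `d` up to limiter
dissipation, so that the second-order terms of the square of the new value cancel. -/
theorem sq_μ_mul_sq_d_add_le : S.μ m ^ 2 * S.d m ^ 2 + S.d m * (S.r m + S.r (m + 2)) ≤
    κ / 8 * S.Z m + 5 / 2 * κ * (ℓ₂ * |S.d m| ^ 3) + S.e m * S.d m ^ 2 / 2 := by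
  have hμν : S.μ m ^ 2 - S.ν m ^ 2 ≤ 2 * κ * (ℓ₂ * |S.d m|) :=
    le_of_abs_le (sq_sub_sq_le (S.abs_μ_le m) (S.abs_ν_le m) (S.abs_μ_sub_ν_le m))
  have hμν' : S.μ m ^ 2 - S.ν (m + 2) ^ 2 ≤ 2 * κ * (ℓ₂ * |S.d m| + S.e m) :=
    le_of_abs_le (sq_sub_sq_le (S.abs_μ_le m) (S.abs_ν_le _) (S.abs_μ_sub_ν_succ_le m))
  have hleft := S.d_mul_r_add_sq_le m (S.abs_ν_le m) (S.σ_mem m)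
    (S.abs_r_add_le_of_abs_σ_le (S.abs_σ_le m))
  have hright := S.d_mul_r_add_sq_le m (S.abs_ν_le (m + 2)) (S.σ_succ_mem m)
    (S.abs_r_add_le_of_abs_σ_le (S.abs_σ_succ_le m))
  have hZ : κ ^ 2 / 2 * (S.d m * (S.d m - S.σ m)) + κ ^ 2 / 2 * (S.d m * (S.d m - S.σ (m + 2)))
      = κ ^ 2 * S.Z m / 2 := by
    unfold Z
    ring
  have hspeeds := mul_le_mul_of_nonneg_right (add_le_add hμν hμν') (sq_nonneg (S.d m))
  have hcube : (2 * κ * (ℓ₂ * |S.d m|) + 2 * κ * (ℓ₂ * |S.d m| + S.e m)) * S.d m ^ 2 =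
      4 * (κ * (ℓ₂ * |S.d m| ^ 3)) + 2 * (κ * (S.e m * S.d m ^ 2)) := by
    rw [← sq_abs (S.d m)]
    ring
  have hℓ := mul_nonneg S.ℓ₂_nonneg (pow_nonneg (abs_nonneg (S.d m)) 3)
  have he := mul_nonneg (S.e_nonneg m) (sq_nonneg (S.d m))
  have hκZ := mul_le_mul_of_nonneg_right S.sq_κ_le (S.Z_nonneg m)
  have hκℓ := mul_le_mul_of_nonneg_right S.sq_κ_le hℓ
  have hκe := mul_le_mul_of_nonneg_right S.κ_le he
  linarith [mul_nonneg S.κ_nonneg (S.Z_nonneg m), mul_nonneg S.κ_nonneg hℓ]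

theorem μ_mul_d_mul_g_add_le : 2 * (S.μ m * S.d m) * S.g m + S.g m ^ 2 ≤
    κ / 8 * S.Z m + κ / 2 * (ℓ₂ * |S.d m| ^ 3) + S.e m * S.d m ^ 2 / 2 := by
  have hκ := S.κ_nonneg
  have hκ2 := S.sq_κ_le
  have hZ := mul_nonneg hκ (S.Z_nonneg m)
  have hℓ := mul_nonneg hκ (mul_nonneg S.ℓ₂_nonneg (pow_nonneg (abs_nonneg (S.d m)) 3))
  have he := mul_nonneg (S.e_nonneg m) (sq_nonneg (S.d m))
  have hfirst : |2 * (S.μ m * S.d m) + S.g m| ≤ 3 * κ * |S.d m| := by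
    have := abs_mul_le_mul (S.abs_μ_le m) (le_refl |S.d m|)
    have hg := S.abs_g_le m
    rw [abs_le] at this hg ⊢
    constructor <;> linarith
  calc 2 * (S.μ m * S.d m) * S.g m + S.g m ^ 2
      = (2 * (S.μ m * S.d m) + S.g m) * S.g m := by ring
    _ ≤ 3 * κ * |S.d m| * (κ ^ 2 / 2 * |S.σ (m + 2) - S.σ m| + 3 * κ * ℓ₂ * S.d m ^ 2
          + κ * S.e m * |S.d m|) := mul_le_mul_of_abs_le hfirst (S.abs_g_le_of_variation m)
    _ = κ ^ 2 * (3 / 2 * (κ * (|S.σ (m + 2) - S.σ m| * |S.d m|)))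
          + κ ^ 2 * (9 * (ℓ₂ * |S.d m| ^ 3)) + κ ^ 2 * (3 * (S.e m * S.d m ^ 2)) := by
        rw [← sq_abs (S.d m)]
        ring
    _ ≤ 1 / 7500 * (3 / 2 * (κ * S.Z m)) + κ / 7500 * (9 * (ℓ₂ * |S.d m| ^ 3))
          + 1 / 7500 * (3 * (S.e m * S.d m ^ 2)) := by
        have h1 : κ ^ 2 ≤ 1 / 7500 := hκ2.trans (by linarith [S.κ_le])
        have := S.ℓ₂_nonneg
        gcongr
        exact S.abs_σ_sub_mul_le_Z m
    _ ≤ κ / 8 * S.Z m + κ / 2 * (ℓ₂ * |S.d m| ^ 3) + S.e m * S.d m ^ 2 / 2 := by linarith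

/-- The numerical flux of the entropy `u²`. -/
def entropyNumFlux : ℝ := -(S.u m ^ 2 / 2) + S.u m * S.σ m / 4 + 2 * (S.u m * S.r m) + S.q m

theorem sq_new_add_ε_le : (S.v (m + 1) + S.ε m) ^ 2 ≤
    S.u m ^ 2 + (S.entropyNumFlux m - S.entropyNumFlux (m + 2))
      + ((S.d m)⁺ ^ 2 * (S.ν' m - S.ν m) / 2 - ℓ₁ / 6 * (S.d m)⁻ ^ 3)
      - (7 / 64 - κ) * S.Z m + 3 * κ * ℓ₂ * |S.d m| ^ 3 + (1 + S.d m ^ 2) * S.e m := by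
  have hexpand : (S.v (m + 1) + S.ε m) ^ 2 =
      (S.u m ^ 2 + S.u (m + 2) ^ 2) / 2
        - (S.u (m + 2) * S.σ (m + 2) - S.u m * S.σ m) / 4
        - 2 * (S.u (m + 2) * S.r (m + 2) - S.u m * S.r m)
        + -((S.u m + S.u (m + 2)) * (S.μ m * S.d m)) - S.Z m / 8
        + (S.σ (m + 2) - S.σ m) ^ 2 / 64
        + (S.σ (m + 2) - S.σ m) / 4 * (S.μ m * S.d m + S.g m)
        + (S.μ m ^ 2 * S.d m ^ 2 + S.d m * (S.r m + S.r (m + 2)))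
        + (2 * (S.μ m * S.d m) * S.g m + S.g m ^ 2) := by
    rw [S.v_eq]
    unfold Z g d
    ring
  have hent : -((S.u m + S.u (m + 2)) * (S.μ m * S.d m)) ≤ S.q m - S.q (m + 2)
      + ((S.d m)⁺ ^ 2 * (S.ν' m - S.ν m) / 2 - ℓ₁ / 6 * (S.d m)⁻ ^ 3) + S.e m := S.entropy_le m
  have hκZ := mul_nonneg S.κ_nonneg (S.Z_nonneg m)
  rw [hexpand]
  unfold entropyNumFlux
  linarith [S.sq_σ_sub_le_Z m, S.σ_sub_mul_le_Z m, S.sq_μ_mul_sq_d_add_le m,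
    S.μ_mul_d_mul_g_add_le m]

theorem sq_new_le : S.v (m + 1) ^ 2 ≤
    S.u m ^ 2 + (S.entropyNumFlux m - S.entropyNumFlux (m + 2))
      + ((S.d m)⁺ ^ 2 * (S.ν' m - S.ν m) / 2 - ℓ₁ / 6 * (S.d m)⁻ ^ 3)
      - (7 / 64 - κ) * S.Z m + 3 * κ * ℓ₂ * |S.d m| ^ 3 + (1 + 2 * U + 4 * U ^ 2) * S.e m := by
  have hv : |S.v (m + 1) + S.ε m - S.ε m| ≤ U := by
    rw [add_sub_cancel_right]
    exact S.abs_v_le _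
  have hsq := sq_sub_le_sq_add hv
  rw [add_sub_cancel_right] at hsq
  have hε := mul_le_mul_of_nonneg_left (S.abs_ε_le m) S.U_nonneg
  have hd := mul_le_mul_of_nonneg_right (S.sq_d_le m) (S.e_nonneg m)
  linarith [S.sq_new_add_ε_le m]

/-! ### Decay of positive jumps -/

/-- The positive part of the jump across edge `m`. -/
def p : ℝ := (S.d m)⁺

/-- The variation across edge `m` of the positive parts of the slopes. -/
def τ : ℝ := (S.σ (m + 2))⁺ - (S.σ m)⁺

/-- The size of the jump of the slope fluxes across an upward edge. -/
def z : ℝ := if 0 < S.d m then |S.g m| else 0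

theorem p_nonneg : 0 ≤ S.p m := posPart_nonneg _

theorem p_le_abs_d : S.p m ≤ |S.d m| := posPart_le_abs _

theorem p_le : S.p m ≤ 2 * U := (S.p_le_abs_d m).trans (S.abs_d_le m)

theorem abs_τ_le_p : |S.τ m| ≤ S.p m :=
  (abs_sub_le_of_mem_uIcc_zero (posPart_mem_uIcc_zero (S.σ_mem m))
    (posPart_mem_uIcc_zero (S.σ_succ_mem m))).trans_eq (abs_of_nonneg (S.p_nonneg m))

theorem p_mul_sub_posPart_σ_le_Z : S.p m * (S.p m - (S.σ m)⁺) ≤ S.Z m := by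
  have hleft : S.p m * (S.p m - (S.σ m)⁺) ≤ S.d m * (S.d m - S.σ m) :=
    posPart_mul_sub_posPart_le (S.σ_mem m)
  have hright : 0 ≤ S.d m * (S.d m - S.σ (m + 2)) :=
    mul_sub_nonneg_of_mem_uIcc_zero (S.σ_succ_mem m)
  unfold Z
  linarith

theorem p_mul_sub_posPart_σ_succ_le_Z : S.p m * (S.p m - (S.σ (m + 2))⁺) ≤ S.Z m := by
  have hleft : 0 ≤ S.d m * (S.d m - S.σ m) := mul_sub_nonneg_of_mem_uIcc_zero (S.σ_mem m)
  have hright : S.p m * (S.p m - (S.σ (m + 2))⁺) ≤ S.d m * (S.d m - S.σ (m + 2)) :=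
    posPart_mul_sub_posPart_le (S.σ_succ_mem m)
  unfold Z
  linarith

theorem abs_τ_mul_p_le_Z : |S.τ m| * S.p m ≤ S.Z m := by
  have hσ : S.p m * (S.p m - (S.σ m)⁺) ≤ S.d m * (S.d m - S.σ m) :=
    posPart_mul_sub_posPart_le (S.σ_mem m)
  have hσ' : S.p m * (S.p m - (S.σ (m + 2))⁺) ≤ S.d m * (S.d m - S.σ (m + 2)) :=
    posPart_mul_sub_posPart_le (S.σ_succ_mem m)
  calc |S.τ m| * S.p m = |S.τ m| * |S.p m| := by rw [abs_of_nonneg (S.p_nonneg m)]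
    _ ≤ S.p m * (2 * S.p m - (S.σ m)⁺ - (S.σ (m + 2))⁺) :=
        abs_sub_mul_abs_le_of_mem_uIcc_zero (posPart_mem_uIcc_zero (S.σ_mem m))
          (posPart_mem_uIcc_zero (S.σ_succ_mem m))
    _ ≤ S.Z m := by
        unfold Z
        linarith

theorem sq_τ_le_Z : S.τ m ^ 2 ≤ S.Z m := by
  calc S.τ m ^ 2 = |S.τ m| * |S.τ m| := by rw [abs_mul_abs_self, sq]
    _ ≤ |S.τ m| * S.p m := mul_le_mul_of_nonneg_left (S.abs_τ_le_p m) (abs_nonneg _)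
    _ ≤ S.Z m := S.abs_τ_mul_p_le_Z m

/-- The limited slope at a node has the smaller of the adjacent positive jumps as positive part, so
that the limiter dissipation of the larger jump controls their difference. -/
theorem max_p_mul_abs_sub_le :
    max (S.p m) (S.p (m + 2)) * |S.p (m + 2) - S.p m| ≤ S.Z m + S.Z (m + 2) := by
  have hmin : (S.σ (m + 2))⁺ = min (S.p m) (S.p (m + 2)) := S.posPart_σ_succ m
  rcases le_total (S.p m) (S.p (m + 2)) with h | h
  · have hlim := S.p_mul_sub_posPart_σ_le_Z (m + 2)
    rw [hmin, min_eq_left h] at hlim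
    rw [max_eq_right h, abs_of_nonneg (sub_nonneg.2 h)]
    linarith [S.Z_nonneg m]
  · have hlim := S.p_mul_sub_posPart_σ_succ_le_Z m
    rw [hmin, min_eq_right h] at hlim
    rw [max_eq_left h, abs_of_nonpos (sub_nonpos.2 h)]
    linarith [S.Z_nonneg (m + 2)]

theorem p_mul_abs_sub_le : S.p m * |S.p (m + 2) - S.p m| ≤ S.Z m + S.Z (m + 2) :=
  (mul_le_mul_of_nonneg_right (le_max_left _ _) (abs_nonneg _)).trans (S.max_p_mul_abs_sub_le m)

theorem p_succ_mul_abs_sub_le : S.p (m + 2) * |S.p (m + 2) - S.p m| ≤ S.Z m + S.Z (m + 2) :=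
  (mul_le_mul_of_nonneg_right (le_max_right _ _) (abs_nonneg _)).trans (S.max_p_mul_abs_sub_le m)

theorem sq_p_sub_le : (S.p (m + 2) - S.p m) ^ 2 ≤ S.Z m + S.Z (m + 2) := by
  have h : |S.p (m + 2) - S.p m| ≤ max (S.p m) (S.p (m + 2)) :=
    abs_le.2 ⟨by linarith [le_max_left (S.p m) (S.p (m + 2)), S.p_nonneg (m + 2)],
      by linarith [le_max_right (S.p m) (S.p (m + 2)), S.p_nonneg m]⟩
  calc (S.p (m + 2) - S.p m) ^ 2 = |S.p (m + 2) - S.p m| * |S.p (m + 2) - S.p m| := by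
        rw [abs_mul_abs_self, sq]
    _ ≤ max (S.p m) (S.p (m + 2)) * |S.p (m + 2) - S.p m| :=
        mul_le_mul_of_nonneg_right h (abs_nonneg _)
    _ ≤ S.Z m + S.Z (m + 2) := S.max_p_mul_abs_sub_le m

theorem abs_τ_add_mul_p_add_le :
    (|S.τ m| + |S.τ (m + 2)|) * (S.p m + S.p (m + 2)) ≤ 4 * (S.Z m + S.Z (m + 2)) := by
  have hsub := le_abs_self (S.p (m + 2) - S.p m)
  have hsub' := neg_abs_le (S.p (m + 2) - S.p m)
  have hcross : |S.τ m| * S.p (m + 2) ≤ |S.τ m| * S.p m + S.p m * |S.p (m + 2) - S.p m| :=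
    calc |S.τ m| * S.p (m + 2) ≤ |S.τ m| * (S.p m + |S.p (m + 2) - S.p m|) := by
          gcongr
          linarith
      _ = |S.τ m| * S.p m + |S.τ m| * |S.p (m + 2) - S.p m| := mul_add _ _ _
      _ ≤ |S.τ m| * S.p m + S.p m * |S.p (m + 2) - S.p m| := by
          gcongr
          exact S.abs_τ_le_p m
  have hcross' : |S.τ (m + 2)| * S.p m ≤
      |S.τ (m + 2)| * S.p (m + 2) + S.p (m + 2) * |S.p (m + 2) - S.p m| :=
    calc |S.τ (m + 2)| * S.p m ≤ |S.τ (m + 2)| * (S.p (m + 2) + |S.p (m + 2) - S.p m|) := by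
          gcongr
          linarith
      _ = |S.τ (m + 2)| * S.p (m + 2) + |S.τ (m + 2)| * |S.p (m + 2) - S.p m| := mul_add _ _ _
      _ ≤ |S.τ (m + 2)| * S.p (m + 2) + S.p (m + 2) * |S.p (m + 2) - S.p m| := by
          gcongr
          exact S.abs_τ_le_p _
  linarith [S.abs_τ_mul_p_le_Z m, S.abs_τ_mul_p_le_Z (m + 2), S.p_mul_abs_sub_le m,
    S.p_succ_mul_abs_sub_le m]

theorem z_nonneg : 0 ≤ S.z m := by
  unfold z
  split_ifs
  exacts [abs_nonneg _, le_rfl]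

theorem z_le : S.z m ≤ κ * S.p m := by
  unfold z p
  split_ifs with hd
  · rw [posPart_of_nonneg hd.le]
    exact (S.abs_g_le m).trans_eq (by rw [abs_of_pos hd])
  · exact mul_nonneg S.κ_nonneg (posPart_nonneg _)

theorem z_le_of_variation : S.z m ≤
    κ ^ 2 / 2 * |S.τ m| + 3 * κ * ℓ₂ * S.p m ^ 2 + κ * S.e m * S.p m := by
  unfold z
  split_ifs with hd
  · have hσ := Set.uIcc_of_le hd.le ▸ S.σ_mem m
    have hσ' := Set.uIcc_of_le hd.le ▸ S.σ_succ_mem m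
    unfold τ p
    rw [posPart_of_nonneg hd.le, posPart_of_nonneg hσ.1, posPart_of_nonneg hσ'.1]
    exact (S.abs_g_le_of_variation m).trans_eq (by rw [abs_of_pos hd])
  · have := S.κ_nonneg
    have := S.ℓ₂_nonneg
    have := S.e_nonneg m
    have := S.p_nonneg m
    positivity

theorem abs_corrections_sub_le :
    |(S.σ (m + 2) - S.σ m) / 8 + S.μ m * S.d m + S.g m - (S.τ m / 8 + S.μ m * S.p m)| ≤
      S.z m + (S.d m)⁻ / 2 := by
  unfold z τ p
  rcases lt_or_ge 0 (S.d m) with hd | hd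
  · have hσ := Set.uIcc_of_le hd.le ▸ S.σ_mem m
    have hσ' := Set.uIcc_of_le hd.le ▸ S.σ_succ_mem m
    rw [if_pos hd, posPart_of_nonneg hd.le, posPart_of_nonneg hσ.1, posPart_of_nonneg hσ'.1,
      negPart_of_nonneg hd.le]
    ring_nf
    exact le_rfl
  · have hσ := Set.uIcc_of_ge hd ▸ S.σ_mem m
    have hσ' := Set.uIcc_of_ge hd ▸ S.σ_succ_mem m
    rw [if_neg hd.not_gt, posPart_of_nonpos hd, posPart_of_nonpos hσ.2, posPart_of_nonpos hσ'.2,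
      negPart_of_nonpos hd]
    have hμ := abs_mul_le_mul (S.abs_μ_le m) (le_refl |S.d m|)
    have hg := S.abs_g_le m
    have hκ := mul_le_mul_of_nonneg_right S.κ_le (abs_nonneg (S.d m))
    rw [abs_of_nonpos hd] at hμ hg hκ
    rw [abs_le] at hμ hg ⊢
    constructor <;> linarith [hσ.1, hσ.2, hσ'.1, hσ'.2]

/-- An upper bound, up to the errors `e`, for the new jump at node `m + 2` in terms of the positive
parts of the old jumps on the two edges at this node. -/
def jumpMajorant : ℝ :=
  (S.p m + S.p (m + 2)) / 2 - (S.τ (m + 2) - S.τ m) / 8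
    - (S.μ (m + 2) * S.p (m + 2) - S.μ m * S.p m) + (S.z m + S.z (m + 2))

theorem new_sub_new_le :
    S.v (m + 2 + 1) - S.v (m + 1) ≤ S.jumpMajorant m + (S.e m + S.e (m + 2)) := by
  have hleft := le_of_abs_le (S.abs_corrections_sub_le m)
  have hright := neg_le_of_abs_le (S.abs_corrections_sub_le (m + 2))
  have hd : S.p m - (S.d m)⁻ = S.d m := posPart_sub_negPart _
  have hd' : S.p (m + 2) - (S.d (m + 2))⁻ = S.d (m + 2) := posPart_sub_negPart _
  have hexpand : S.v (m + 2 + 1) - S.v (m + 1) = (S.d m + S.d (m + 2)) / 2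
      + ((S.σ (m + 2) - S.σ m) / 8 + S.μ m * S.d m + S.g m)
      - ((S.σ (m + 2 + 2) - S.σ (m + 2)) / 8 + S.μ (m + 2) * S.d (m + 2) + S.g (m + 2))
      + S.ε m - S.ε (m + 2) := by
    rw [S.v_eq, S.v_eq]
    unfold g d
    ring
  rw [hexpand]
  unfold jumpMajorant
  linarith [le_of_abs_le (S.abs_ε_le m), neg_le_of_abs_le (S.abs_ε_le (m + 2))]

theorem sq_jumpMajorant_center_le :
    ((S.p m + S.p (m + 2)) / 2 - (S.τ (m + 2) - S.τ m) / 8) ^ 2 ≤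
      (S.p m ^ 2 + S.p (m + 2) ^ 2) / 2 - (S.p (m + 2) * S.τ (m + 2) - S.p m * S.τ m) / 4
        + (S.Z m + S.Z (m + 2)) / 32 := by
  linarith [S.sq_τ_le_Z m, S.sq_τ_le_Z (m + 2),
    sq_nonneg ((S.p (m + 2) - S.p m) / 2 - (S.τ (m + 2) + S.τ m) / 8)]

theorem abs_μ_mul_p_le : |S.μ m * S.p m| ≤ κ * S.p m :=
  abs_mul_le_mul (S.abs_μ_le m) (abs_of_nonneg (S.p_nonneg m)).le

theorem τ_sub_mul_le :
    2 * ((S.τ (m + 2) - S.τ m) / 8) * (S.μ (m + 2) * S.p (m + 2) - S.μ m * S.p m) ≤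
      κ * (S.Z m + S.Z (m + 2)) := by
  have hτ : |2 * ((S.τ (m + 2) - S.τ m) / 8)| ≤ (|S.τ m| + |S.τ (m + 2)|) / 4 := by
    have := abs_sub (S.τ (m + 2)) (S.τ m)
    rw [abs_le] at this ⊢
    constructor <;> linarith
  have hη : |S.μ (m + 2) * S.p (m + 2) - S.μ m * S.p m| ≤ κ * (S.p m + S.p (m + 2)) :=
    (abs_sub _ _).trans (by linarith [S.abs_μ_mul_p_le m, S.abs_μ_mul_p_le (m + 2)])
  linarith [mul_le_mul_of_abs_le hτ hη,
    mul_le_mul_of_nonneg_left (S.abs_τ_add_mul_p_add_le m) S.κ_nonneg]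

/-- Genuine nonlinearity: the differences of the speeds `ν' - μ` on the left edge and `μ - ν` on the
right edge compress a positive jump. -/
theorem neg_p_add_mul_le :
    -((S.p m + S.p (m + 2)) * (S.μ (m + 2) * S.p (m + 2) - S.μ m * S.p m)) ≤
      -(S.μ (m + 2) * S.p (m + 2) ^ 2 - S.μ m * S.p m ^ 2)
        - S.p (m + 2) ^ 2 * (S.μ (m + 2) - S.ν (m + 2)) - S.p m ^ 2 * (S.ν' m - S.μ m)
        + 4 * κ * (S.Z m + S.Z (m + 2)) + (S.e m + S.e (m + 2)) * (S.p m + S.p (m + 2)) ^ 2 := by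
  have hμν : |S.μ (m + 2) - S.ν (m + 2)| ≤ 2 * κ :=
    (abs_sub _ _).trans (by linarith [S.abs_μ_le (m + 2), S.abs_ν_le (m + 2)])
  have hνμ : |S.ν (m + 2) - S.μ m| ≤ 2 * κ :=
    (abs_sub _ _).trans (by linarith [S.abs_μ_le m, S.abs_ν_le (m + 2)])
  have hp (x : ℝ) (hx : 0 ≤ x) (hxZ : x * |S.p (m + 2) - S.p m| ≤ S.Z m + S.Z (m + 2)) :
      |x * (S.p (m + 2) - S.p m)| ≤ S.Z m + S.Z (m + 2) := by
    rwa [abs_mul, abs_of_nonneg hx]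
  have hright := le_of_abs_le
    (abs_mul_le_mul (hp _ (S.p_nonneg (m + 2)) (S.p_succ_mul_abs_sub_le m)) hμν)
  have hleft := neg_le_of_abs_le (abs_mul_le_mul (hp _ (S.p_nonneg m) (S.p_mul_abs_sub_le m)) hνμ)
  have herror : S.p m ^ 2 * (S.ν' m - S.ν (m + 2)) ≤ (S.p m + S.p (m + 2)) ^ 2 * S.e m := by
    have := S.p_nonneg m
    have := S.p_nonneg (m + 2)
    have := S.e_nonneg m
    have := neg_le_of_abs_le (S.abs_ν_succ_sub_ν'_le m)
    calc S.p m ^ 2 * (S.ν' m - S.ν (m + 2)) ≤ S.p m ^ 2 * S.e m := by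
          gcongr
          linarith
      _ ≤ (S.p m + S.p (m + 2)) ^ 2 * S.e m := by
          gcongr
          linarith
  linarith [mul_nonneg (S.e_nonneg (m + 2)) (sq_nonneg (S.p m + S.p (m + 2)))]

theorem p_add_mul_z_add_le :
    (S.p m + S.p (m + 2)) * (S.z m + S.z (m + 2)) ≤
      2 * κ ^ 2 * (S.Z m + S.Z (m + 2)) + 6 * κ * ℓ₂ * (|S.d m| ^ 3 + |S.d (m + 2)| ^ 3)
        + κ * (S.e m + S.e (m + 2)) * (S.p m + S.p (m + 2)) ^ 2 := by
  have hκ := S.κ_nonneg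
  have hℓ := S.ℓ₂_nonneg
  have hp := S.p_nonneg m
  have hp' := S.p_nonneg (m + 2)
  have hcubes : (S.p m + S.p (m + 2)) * (S.p m ^ 2 + S.p (m + 2) ^ 2) ≤
      2 * (|S.d m| ^ 3 + |S.d (m + 2)| ^ 3) := by
    have h := pow_le_pow_left₀ hp (S.p_le_abs_d m) 3
    have h' := pow_le_pow_left₀ hp' (S.p_le_abs_d (m + 2)) 3
    linarith [mul_nonneg (add_nonneg hp hp') (sq_nonneg (S.p m - S.p (m + 2)))]
  have herrors : S.e m * S.p m + S.e (m + 2) * S.p (m + 2) ≤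
      (S.e m + S.e (m + 2)) * (S.p m + S.p (m + 2)) := by
    linarith [mul_nonneg (S.e_nonneg m) hp', mul_nonneg (S.e_nonneg (m + 2)) hp]
  calc (S.p m + S.p (m + 2)) * (S.z m + S.z (m + 2))
      ≤ (S.p m + S.p (m + 2)) *
          ((κ ^ 2 / 2 * |S.τ m| + 3 * κ * ℓ₂ * S.p m ^ 2 + κ * S.e m * S.p m)
          + (κ ^ 2 / 2 * |S.τ (m + 2)| + 3 * κ * ℓ₂ * S.p (m + 2) ^ 2
            + κ * S.e (m + 2) * S.p (m + 2))) := by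
        gcongr
        exacts [S.z_le_of_variation m, S.z_le_of_variation (m + 2)]
    _ = κ ^ 2 / 2 * ((|S.τ m| + |S.τ (m + 2)|) * (S.p m + S.p (m + 2)))
          + 3 * κ * ℓ₂ * ((S.p m + S.p (m + 2)) * (S.p m ^ 2 + S.p (m + 2) ^ 2))
          + κ * (S.p m + S.p (m + 2)) * (S.e m * S.p m + S.e (m + 2) * S.p (m + 2)) := by ring
    _ ≤ 2 * κ ^ 2 * (S.Z m + S.Z (m + 2)) + 6 * κ * ℓ₂ * (|S.d m| ^ 3 + |S.d (m + 2)| ^ 3)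
          + κ * (S.e m + S.e (m + 2)) * (S.p m + S.p (m + 2)) ^ 2 := by
        have hτ : 0 ≤ κ ^ 2 / 2 := by positivity
        have hp3 : 0 ≤ 3 * κ * ℓ₂ := by positivity
        have hpe : 0 ≤ κ * (S.p m + S.p (m + 2)) := by positivity
        linarith [mul_le_mul_of_nonneg_left (S.abs_τ_add_mul_p_add_le m) hτ,
          mul_le_mul_of_nonneg_left hcubes hp3, mul_le_mul_of_nonneg_left herrors hpe]

theorem sq_z_add_le :
    2 * (S.z m + S.z (m + 2)) ^ 2 ≤ (S.p m + S.p (m + 2)) * (S.z m + S.z (m + 2)) := by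
  have hz : S.z m + S.z (m + 2) ≤ (S.p m + S.p (m + 2)) / 2 := by
    have h := mul_le_mul_of_nonneg_right S.κ_le (add_nonneg (S.p_nonneg m) (S.p_nonneg (m + 2)))
    linarith [S.z_le m, S.z_le (m + 2), S.p_nonneg m, S.p_nonneg (m + 2)]
  linarith [mul_le_mul_of_nonneg_right hz (add_nonneg (S.z_nonneg m) (S.z_nonneg (m + 2)))]

theorem abs_μ_succ_sub_μ_le : |S.μ (m + 2) - S.μ m| ≤ ℓ₂ * (|S.d m| + |S.d (m + 2)|) + S.e m := by
  have h : |S.μ (m + 2) - S.ν (m + 2)| ≤ ℓ₂ * |S.d (m + 2)| := S.abs_μ_sub_ν_le (m + 2)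
  have h' := S.abs_μ_sub_ν_succ_le m
  rw [abs_le] at h h' ⊢
  constructor <;> linarith

theorem sq_μ_succ_sub_μ_mul_le : (S.μ (m + 2) - S.μ m) ^ 2 * S.p m ^ 2 ≤
    4 * κ * ℓ₂ * (|S.d m| ^ 3 + |S.d (m + 2)| ^ 3)
      + 2 * κ * ((S.e m + S.e (m + 2)) * (S.p m + S.p (m + 2)) ^ 2) := by
  have hκ := S.κ_nonneg
  have hℓ := S.ℓ₂_nonneg
  have hp := S.p_nonneg m
  have hp' := S.p_nonneg (m + 2)
  have he := S.e_nonneg m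
  have he' := S.e_nonneg (m + 2)
  have hμ : |S.μ (m + 2) - S.μ m| ≤ 2 * κ :=
    (abs_sub _ _).trans (by linarith [S.abs_μ_le m, S.abs_μ_le (m + 2)])
  have hcubes : (|S.d m| + |S.d (m + 2)|) * S.p m ^ 2 ≤
      2 * (|S.d m| ^ 3 + |S.d (m + 2)| ^ 3) := by
    have h := pow_le_pow_left₀ hp (S.p_le_abs_d m) 2
    have hmul := mul_le_mul_of_nonneg_left h
      (add_nonneg (abs_nonneg (S.d m)) (abs_nonneg (S.d (m + 2))))
    linarith [mul_sq_le_cube_add_cube (abs_nonneg (S.d (m + 2))) (abs_nonneg (S.d m)),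
      pow_nonneg (abs_nonneg (S.d (m + 2))) 3]
  calc (S.μ (m + 2) - S.μ m) ^ 2 * S.p m ^ 2
      = |S.μ (m + 2) - S.μ m| * |S.μ (m + 2) - S.μ m| * S.p m ^ 2 := by
        rw [abs_mul_abs_self, sq (S.μ (m + 2) - S.μ m)]
    _ ≤ 2 * κ * (ℓ₂ * (|S.d m| + |S.d (m + 2)|) + S.e m) * S.p m ^ 2 := by
        gcongr
        exact S.abs_μ_succ_sub_μ_le m
    _ = 2 * κ * ℓ₂ * ((|S.d m| + |S.d (m + 2)|) * S.p m ^ 2) + 2 * κ * (S.e m * S.p m ^ 2) := by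
        ring
    _ ≤ 2 * κ * ℓ₂ * (2 * (|S.d m| ^ 3 + |S.d (m + 2)| ^ 3))
          + 2 * κ * ((S.e m + S.e (m + 2)) * (S.p m + S.p (m + 2)) ^ 2) := by
        gcongr <;> linarith
    _ = _ := by ring

theorem sq_μ_mul_p_sub_le : 2 * (S.μ (m + 2) * S.p (m + 2) - S.μ m * S.p m) ^ 2 ≤
    4 * κ ^ 2 * (S.Z m + S.Z (m + 2)) + 16 * κ * ℓ₂ * (|S.d m| ^ 3 + |S.d (m + 2)| ^ 3)
      + 8 * κ * ((S.e m + S.e (m + 2)) * (S.p m + S.p (m + 2)) ^ 2) := by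
  have hμ : S.μ (m + 2) ^ 2 ≤ κ ^ 2 :=
    sq_le_sq' (neg_le_of_abs_le (S.abs_μ_le _)) (le_of_abs_le (S.abs_μ_le _))
  have hp : S.μ (m + 2) ^ 2 * (S.p (m + 2) - S.p m) ^ 2 ≤ κ ^ 2 * (S.Z m + S.Z (m + 2)) :=
    mul_le_mul hμ (S.sq_p_sub_le m) (sq_nonneg _) (sq_nonneg _)
  linarith [S.sq_μ_succ_sub_μ_mul_le m,
    sq_nonneg (S.μ (m + 2) * (S.p (m + 2) - S.p m) - (S.μ (m + 2) - S.μ m) * S.p m)]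

theorem center_mul_z_add_le :
    2 * ((S.p m + S.p (m + 2)) / 2 - (S.τ (m + 2) - S.τ m) / 8) * (S.z m + S.z (m + 2)) ≤
      2 * ((S.p m + S.p (m + 2)) * (S.z m + S.z (m + 2))) := by
  have hcenter : (S.p m + S.p (m + 2)) / 2 - (S.τ (m + 2) - S.τ m) / 8 ≤ S.p m + S.p (m + 2) := by
    linarith [le_of_abs_le (S.abs_τ_le_p m), neg_le_of_abs_le (S.abs_τ_le_p (m + 2)),
      S.p_nonneg m, S.p_nonneg (m + 2)]
  linarith [mul_le_mul_of_nonneg_right hcenter (add_nonneg (S.z_nonneg m) (S.z_nonneg (m + 2)))]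

theorem sq_jumpMajorant_le : S.jumpMajorant m ^ 2 ≤
    (S.p m ^ 2 + S.p (m + 2) ^ 2) / 2 - (S.p (m + 2) * S.τ (m + 2) - S.p m * S.τ m) / 4
      - (S.μ (m + 2) * S.p (m + 2) ^ 2 - S.μ m * S.p m ^ 2)
      - S.p (m + 2) ^ 2 * (S.μ (m + 2) - S.ν (m + 2)) - S.p m ^ 2 * (S.ν' m - S.μ m)
      + (1 / 32 + 7 * κ) * (S.Z m + S.Z (m + 2))
      + 34 * κ * ℓ₂ * (|S.d m| ^ 3 + |S.d (m + 2)| ^ 3)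
      + 2 * (S.e m + S.e (m + 2)) * (S.p m + S.p (m + 2)) ^ 2 := by
  have hE : 0 ≤ (S.e m + S.e (m + 2)) * (S.p m + S.p (m + 2)) ^ 2 :=
    mul_nonneg (add_nonneg (S.e_nonneg _) (S.e_nonneg _)) (sq_nonneg _)
  have hZ := add_nonneg (S.Z_nonneg m) (S.Z_nonneg (m + 2))
  have hκZ := mul_le_mul_of_nonneg_right S.sq_κ_le hZ
  have hκE := mul_le_mul_of_nonneg_right S.κ_le hE
  have hexpand : S.jumpMajorant m ^ 2 =
      ((S.p m + S.p (m + 2)) / 2 - (S.τ (m + 2) - S.τ m) / 8) ^ 2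
      + -((S.p m + S.p (m + 2)) * (S.μ (m + 2) * S.p (m + 2) - S.μ m * S.p m))
      + 2 * ((S.τ (m + 2) - S.τ m) / 8) * (S.μ (m + 2) * S.p (m + 2) - S.μ m * S.p m)
      + 2 * ((S.p m + S.p (m + 2)) / 2 - (S.τ (m + 2) - S.τ m) / 8) * (S.z m + S.z (m + 2))
      + ((S.μ (m + 2) * S.p (m + 2) - S.μ m * S.p m) - (S.z m + S.z (m + 2))) ^ 2 := by
    unfold jumpMajorant
    ring
  have hsquare := sq_nonneg
    ((S.μ (m + 2) * S.p (m + 2) - S.μ m * S.p m) + (S.z m + S.z (m + 2)))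
  rw [hexpand]
  linarith [S.sq_jumpMajorant_center_le m, S.neg_p_add_mul_le m, S.τ_sub_mul_le m,
    S.center_mul_z_add_le m, S.p_add_mul_z_add_le m, S.sq_z_add_le m, S.sq_μ_mul_p_sub_le m,
    mul_nonneg S.κ_nonneg hZ]

/-! ### The Lyapunov inequality -/

/-- The numerical flux of the squared positive jumps. -/
def jumpNumFlux : ℝ :=
  S.p m ^ 2 / 2 + S.p m * S.τ m / 4 + S.μ m * S.p m ^ 2 + (1 / 32 + 7 * κ) * S.Z m
    - S.p m ^ 2 * (S.ν' m - S.μ m) + 34 * κ * ℓ₂ * |S.d m| ^ 3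

theorem abs_new_sub_new_le : |S.v (m + 2) - S.v m| ≤ 2 * U :=
  (abs_sub _ _).trans (by linarith [S.abs_v_le m, S.abs_v_le (m + 2)])

theorem sq_posPart_new_sub_new_le : (S.v (m + 2 + 1) - S.v (m + 1))⁺ ^ 2 ≤
    S.p (m + 2) ^ 2 + (S.jumpNumFlux m - S.jumpNumFlux (m + 2))
      - S.p (m + 2) ^ 2 * (S.ν' (m + 2) - S.ν (m + 2)) + (1 / 16 + 14 * κ) * S.Z (m + 2)
      + 68 * κ * ℓ₂ * |S.d (m + 2)| ^ 3 + (4 * U + 32 * U ^ 2) * (S.e m + S.e (m + 2)) := by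
  have hE := add_nonneg (S.e_nonneg m) (S.e_nonneg (m + 2))
  have hnew : S.v (m + 2 + 1) - S.v (m + 1) ≤ 2 * U := by
    rw [add_right_comm]
    exact le_of_abs_le (S.abs_new_sub_new_le (m + 1))
  have hmajorant := sq_posPart_le_of_le_add hnew (mul_nonneg zero_le_two S.U_nonneg) hE
    (S.new_sub_new_le m)
  have hjumps : (S.p m + S.p (m + 2)) ^ 2 ≤ (2 * U + 2 * U) ^ 2 :=
    pow_le_pow_left₀ (add_nonneg (S.p_nonneg m) (S.p_nonneg (m + 2)))
      (add_le_add (S.p_le m) (S.p_le (m + 2))) 2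
  unfold jumpNumFlux
  linarith [S.sq_jumpMajorant_le m, mul_le_mul_of_nonneg_left hjumps hE]

theorem ℓ₁_nonneg (S : StaggeredStep κ ℓ₁ ℓ₂ U B) : 0 ≤ ℓ₁ := by
  linarith [S.κ_mul_le, mul_nonneg S.κ_nonneg S.ℓ₂_nonneg]

theorem ℓ₁_mul_cube_le :
    ℓ₁ * |S.d m| ^ 3 ≤ 3 * (S.p m ^ 2 * (S.ν' m - S.ν m)) + ℓ₁ * (S.d m)⁻ ^ 3 := by
  unfold p
  rcases le_total 0 (S.d m) with hd | hd
  · rw [posPart_of_nonneg hd, negPart_of_nonneg hd, abs_of_nonneg hd]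
    have hspeed := mul_le_mul_of_nonneg_left (S.le_ν'_sub_ν m hd) (sq_nonneg (S.d m))
    have hcube := mul_nonneg S.ℓ₁_nonneg (pow_nonneg hd 3)
    have : S.d m ^ 2 * (ℓ₁ * (S.u (m + 2) - S.u m)) = ℓ₁ * S.d m ^ 3 := by
      unfold d
      ring
    linarith
  · rw [posPart_of_nonpos hd, negPart_of_nonpos hd, abs_of_nonpos hd]
    linarith

/-- The numerical flux of the Lyapunov density, through the left half of the edge `m + 2`. -/
def lyapunovFlux : ℝ := S.entropyNumFlux (m + 2) + S.jumpNumFlux m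

theorem sq_new_add_sq_posPart_le :
    S.v (m + 2 + 1) ^ 2 + (S.v (m + 2 + 1) - S.v (m + 1))⁺ ^ 2 ≤
      S.u (m + 2) ^ 2 + S.p (m + 2) ^ 2 + (S.lyapunovFlux m - S.lyapunovFlux (m + 2))
        - ℓ₁ / 8 * |S.d (m + 2)| ^ 3 + (1 + 6 * U + 36 * U ^ 2) * (S.e m + S.e (m + 2)) := by
  have hvalue : S.v (m + 2 + 1) ^ 2 ≤
      S.u (m + 2) ^ 2 + (S.entropyNumFlux (m + 2) - S.entropyNumFlux (m + 2 + 2))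
        + (S.p (m + 2) ^ 2 * (S.ν' (m + 2) - S.ν (m + 2)) / 2 - ℓ₁ / 6 * (S.d (m + 2))⁻ ^ 3)
        - (7 / 64 - κ) * S.Z (m + 2) + 3 * κ * ℓ₂ * |S.d (m + 2)| ^ 3
        + (1 + 2 * U + 4 * U ^ 2) * S.e (m + 2) := S.sq_new_le (m + 2)
  have hU := S.U_nonneg
  have hκZ := mul_le_mul_of_nonneg_right S.κ_le (S.Z_nonneg (m + 2))
  have hκℓ := mul_le_mul_of_nonneg_right S.κ_mul_le (pow_nonneg (abs_nonneg (S.d (m + 2))) 3)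
  have hℓ := mul_nonneg S.ℓ₁_nonneg (pow_nonneg (abs_nonneg (S.d (m + 2))) 3)
  have he := mul_nonneg (by positivity : 0 ≤ 1 + 2 * U + 4 * U ^ 2) (S.e_nonneg m)
  unfold lyapunovFlux
  linarith [S.sq_posPart_new_sub_new_le m, S.ℓ₁_mul_cube_le (m + 2), S.Z_nonneg (m + 2)]

theorem abs_entropyNumFlux_le : |S.entropyNumFlux (m + 2)| ≤ 2 * U ^ 2 + B := by
  have hU := S.U_nonneg
  have hκ2 : κ ^ 2 ≤ 1 / 7500 := S.sq_κ_le.trans (by linarith [S.κ_le])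
  have hr : |S.r (m + 2)| ≤ U / 4 :=
    calc |S.r (m + 2)| ≤ κ ^ 2 * |S.d m| := S.abs_r_succ_le m
      _ ≤ 1 / 7500 * (2 * U) := by
          gcongr
          exact S.abs_d_le m
      _ ≤ U / 4 := by linarith
  have huu := abs_mul_le_mul (S.abs_u_le (m + 2)) (S.abs_u_le (m + 2))
  have huσ := abs_mul_le_mul (S.abs_u_le (m + 2)) ((S.abs_σ_succ_le m).trans (S.abs_d_le m))
  have hur := abs_mul_le_mul (S.abs_u_le (m + 2)) hr
  have hq := S.abs_q_le (m + 2)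
  unfold entropyNumFlux
  rw [abs_le] at huu huσ hur hq ⊢
  constructor <;> linarith

theorem Z_le : S.Z m ≤ 16 * U ^ 2 := by
  have hdd := abs_mul_le_mul (S.abs_d_le m) (S.abs_d_le m)
  have hdσ := abs_mul_le_mul (S.abs_d_le m) ((S.abs_σ_le m).trans (S.abs_d_le m))
  have hdσ' := abs_mul_le_mul (S.abs_d_le m) ((S.abs_σ_succ_le m).trans (S.abs_d_le m))
  unfold Z
  linarith [le_of_abs_le hdd, neg_le_of_abs_le hdσ, neg_le_of_abs_le hdσ']

theorem κ_mul_ℓ₂_mul_cube_le : κ * ℓ₂ * |S.d m| ^ 3 ≤ 1 / 7500 * (4 * U ^ 2) := by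
  have hℓ := S.ℓ₂_nonneg
  calc κ * ℓ₂ * |S.d m| ^ 3 = κ * (ℓ₂ * |S.d m|) * S.d m ^ 2 := by
        rw [← sq_abs (S.d m)]
        ring
    _ ≤ 1 / 7500 * 1 * (4 * U ^ 2) := by
        gcongr
        exacts [S.κ_le, S.ℓ₂_mul_le m, S.sq_d_le m]
    _ = 1 / 7500 * (4 * U ^ 2) := by ring

theorem abs_jumpNumFlux_le : |S.jumpNumFlux m| ≤ 18 * U ^ 2 := by
  have hp : |S.p m| ≤ 2 * U := (abs_of_nonneg (S.p_nonneg m)).trans_le (S.p_le m)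
  have hμ : |S.μ m| ≤ 1 / 7500 := (S.abs_μ_le m).trans S.κ_le
  have hνμ : |S.ν' m - S.μ m| ≤ 2 / 7500 :=
    (abs_sub _ _).trans (by linarith [S.abs_μ_le m, S.abs_ν'_le m, S.κ_le])
  have hpp := abs_mul_le_mul hp hp
  have hpτ := abs_mul_le_mul hp ((S.abs_τ_le_p m).trans (S.p_le m))
  have hμpp := abs_mul_le_mul hμ hpp
  have hppν := abs_mul_le_mul hpp hνμ
  have hZ : 7 * κ * S.Z m ≤ 1 / 32 * S.Z m :=
    mul_le_mul_of_nonneg_right (by linarith [S.κ_le]) (S.Z_nonneg m)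
  have hκZ := mul_nonneg S.κ_nonneg (S.Z_nonneg m)
  have hcube : 0 ≤ κ * ℓ₂ * |S.d m| ^ 3 :=
    mul_nonneg (mul_nonneg S.κ_nonneg S.ℓ₂_nonneg) (pow_nonneg (abs_nonneg _) 3)
  unfold jumpNumFlux
  rw [abs_le, ← sq] at hpp hμpp hppν
  rw [abs_le] at hpτ ⊢
  constructor <;>
    linarith [S.Z_nonneg m, S.Z_le m, S.κ_mul_ℓ₂_mul_cube_le m, sq_nonneg U]

theorem abs_lyapunovFlux_le : |S.lyapunovFlux m| ≤ 20 * U ^ 2 + B :=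
  (abs_add_le _ _).trans (by linarith [S.abs_entropyNumFlux_le m, S.abs_jumpNumFlux_le m])

/-- The potential whose differences account both for `lyapunovFlux` and for the shift by half an
edge between the old and the new cells. -/
def shiftedFlux : ℝ :=
  (S.v (m + 1) - S.v (m - 1))⁺ ^ 2 - S.v m ^ 2 - S.lyapunovFlux (m - 2) - S.lyapunovFlux (m - 1)

theorem shiftedFlux_sub_le (m' : ℤ) : S.shiftedFlux m' - S.shiftedFlux m ≤ 85 * U ^ 2 + 4 * B := by
  have hjump : (S.v (m' + 1) - S.v (m' - 1))⁺ ^ 2 ≤ (2 * U) ^ 2 := by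
    have hv := S.abs_new_sub_new_le (m' - 1)
    rw [show m' - 1 + 2 = m' + 1 by ring] at hv
    exact pow_le_pow_left₀ (posPart_nonneg _) ((posPart_le_abs _).trans hv) 2
  have hv : S.v m ^ 2 ≤ U ^ 2 :=
    sq_le_sq' (neg_le_of_abs_le (S.abs_v_le m)) (le_of_abs_le (S.abs_v_le m))
  unfold shiftedFlux
  linarith [neg_le_of_abs_le (S.abs_lyapunovFlux_le (m' - 2)),
    neg_le_of_abs_le (S.abs_lyapunovFlux_le (m' - 1)),
    le_of_abs_le (S.abs_lyapunovFlux_le (m - 2)), le_of_abs_le (S.abs_lyapunovFlux_le (m - 1)),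
    sq_nonneg (S.v (m + 1) - S.v (m - 1))⁺, sq_nonneg (S.v m')]

theorem sq_new_add_sq_posPart_new_sub_new_le :
    S.v m ^ 2 + (S.v (m + 2) - S.v m)⁺ ^ 2 + ℓ₁ / 8 * |S.u (m + 2) - S.u m| ^ 3 ≤
      S.u m ^ 2 + (S.u (m + 2) - S.u m)⁺ ^ 2
        + (1 + 6 * U + 36 * U ^ 2) * (S.e (m - 2) + S.e m)
        + (S.shiftedFlux (m + 1) - S.shiftedFlux m) := by
  have h := S.sq_new_add_sq_posPart_le (m - 2)
  unfold p d at h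
  rw [sub_add_cancel, show m - 2 + 1 = m - 1 by ring] at h
  unfold shiftedFlux
  rw [add_sub_cancel_right, show m + 1 + 1 = m + 2 by ring, show m + 1 - 2 = m - 1 by ring]
  linarith

end StaggeredStep

/-- The Lyapunov functional `∑ (w² + ((Δw)⁺)²)` over the `L` cells starting at `b`. Cells of both
parities are counted, that is, the two interlaced sublattices are treated at once. -/
def lyapunov (w : ℤ → ℝ) (b : ℤ) (L : ℕ) : ℝ :=
  ∑ t ∈ Finset.range L, (w (b + t) ^ 2 + (w (b + t + 2) - w (b + t))⁺ ^ 2)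

theorem StaggeredStep.lyapunov_new_le {κ ℓ₁ ℓ₂ U B : ℝ} (S : StaggeredStep κ ℓ₁ ℓ₂ U B) (b : ℤ)
    (L : ℕ) :
    lyapunov S.v b L + ℓ₁ / 8 * ∑ t ∈ Finset.range L, |S.u (b + t + 2) - S.u (b + t)| ^ 3 ≤
      lyapunov S.u b L + (1 + 6 * U + 36 * U ^ 2) *
        ∑ t ∈ Finset.range L, (S.e (b + t - 2) + S.e (b + t)) + (85 * U ^ 2 + 4 * B) := by
  have htelescope : ∑ t ∈ Finset.range L, (S.shiftedFlux (b + t + 1) - S.shiftedFlux (b + t)) =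
      S.shiftedFlux (b + L) - S.shiftedFlux b := by
    simpa only [Nat.cast_add, Nat.cast_one, Nat.cast_zero, add_zero, ← add_assoc] using
      Finset.sum_range_sub (fun t : ℕ => S.shiftedFlux (b + t)) L
  unfold lyapunov
  calc _ = ∑ t ∈ Finset.range L, (S.v (b + t) ^ 2 + (S.v (b + t + 2) - S.v (b + t))⁺ ^ 2
        + ℓ₁ / 8 * |S.u (b + t + 2) - S.u (b + t)| ^ 3) := by
        rw [Finset.mul_sum, ← Finset.sum_add_distrib]
    _ ≤ ∑ t ∈ Finset.range L, (S.u (b + t) ^ 2 + (S.u (b + t + 2) - S.u (b + t))⁺ ^ 2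
          + (1 + 6 * U + 36 * U ^ 2) * (S.e (b + t - 2) + S.e (b + t))
          + (S.shiftedFlux (b + t + 1) - S.shiftedFlux (b + t))) :=
        Finset.sum_le_sum fun t _ => S.sq_new_add_sq_posPart_new_sub_new_le (b + t)
    _ ≤ _ := by
        rw [Finset.sum_add_distrib, Finset.sum_add_distrib, ← Finset.mul_sum, htelescope]
        gcongr
        exact S.shiftedFlux_sub_le _ _

/-! ### Uniformly convex fluxes -/

section MonotoneIntegrand

variable {g : ℝ → ℝ} {a b γ : ℝ}

theorem integral_centered_quadratic (a b c₀ c₁ c₂ : ℝ) :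
    ∫ x in a..b, (c₀ + c₁ * (2 * x - a - b) + c₂ * (2 * x - a - b) ^ 2) =
      c₀ * (b - a) + c₂ * (b - a) ^ 3 / 3 := by
  have hderiv (x : ℝ) : HasDerivAt
      (fun x => c₀ * x + c₁ * (2 * x - a - b) ^ 2 / 4 + c₂ * (2 * x - a - b) ^ 3 / 6)
      (c₀ + c₁ * (2 * x - a - b) + c₂ * (2 * x - a - b) ^ 2) x := by
    have hlin : HasDerivAt (fun x : ℝ => 2 * x - a - b) 2 x := by
      simpa only [mul_one] using (((hasDerivAt_id' x).const_mul 2).sub_const a).sub_const b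
    refine ((((hasDerivAt_id' x).const_mul c₀).add
      (((hlin.pow 2).const_mul c₁).div_const 4)).add
        (((hlin.pow 3).const_mul c₂).div_const 6)).congr_deriv ?_
    push_cast
    ring
  rw [intervalIntegral.integral_eq_sub_of_hasDerivAt (fun x _ => hderiv x)
    (Continuous.intervalIntegrable (by fun_prop) a b)]
  ring

theorem integral_mul_le_of_monotoneOn (hab : a ≤ b) (hg : MonotoneOn g (Set.Icc a b)) :
    ∫ x in a..b, (2 * x - a - b) * g x ≤ (b - a) ^ 2 * (g b - g a) / 2 := by
  have hint : IntervalIntegrable (fun x => (2 * x - a - b) * g x) volume a b :=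
    (MonotoneOn.intervalIntegrable (by rwa [Set.uIcc_of_le hab])).continuousOn_mul (by fun_prop)
  calc _ ≤ ∫ x in a..b, ((b - a) * (g b - g a) / 2 + (g a + g b) / 2 * (2 * x - a - b)
        + 0 * (2 * x - a - b) ^ 2) := by
        refine intervalIntegral.integral_mono_on hab hint
          (Continuous.intervalIntegrable (by fun_prop) a b) fun x hx => ?_
        have hga := hg (Set.left_mem_Icc.2 hab) hx hx.1
        have hgb := hg hx (Set.right_mem_Icc.2 hab) hx.2
        have hlin : |2 * x - a - b| ≤ b - a := abs_le.2 ⟨by linarith [hx.1], by linarith [hx.2]⟩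
        have hosc : |g x - (g a + g b) / 2| ≤ (g b - g a) / 2 :=
          abs_le.2 ⟨by linarith, by linarith⟩
        linarith [mul_le_mul_of_abs_le hlin hosc]
    _ = _ := by
        rw [integral_centered_quadratic]
        ring

theorem le_integral_mul_of_le_sub (hab : a ≤ b) (hg : ContinuousOn g (Set.Icc a b))
    (hγ : ∀ x ∈ Set.Icc a b, ∀ y ∈ Set.Icc a b, x ≤ y → γ * (y - x) ≤ g y - g x) :
    γ / 6 * (b - a) ^ 3 ≤ ∫ x in a..b, (2 * x - a - b) * g x := by
  have hmid : (a + b) / 2 ∈ Set.Icc a b := ⟨by linarith, by linarith⟩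
  calc γ / 6 * (b - a) ^ 3 = ∫ x in a..b, (0 + g ((a + b) / 2) * (2 * x - a - b)
        + γ / 2 * (2 * x - a - b) ^ 2) := by
        rw [integral_centered_quadratic]
        ring
    _ ≤ _ := by
        refine intervalIntegral.integral_mono_on hab
          (Continuous.intervalIntegrable (by fun_prop) a b)
          (ContinuousOn.intervalIntegrable_of_Icc hab (by fun_prop)) fun x hx => ?_
        rcases le_total x ((a + b) / 2) with h | h
        · nlinarith [hγ x hx _ hmid h]
        · nlinarith [hγ _ hmid x hx h]

end MonotoneIntegrand

/-- `f` is a flux on `[klo, khi] × [ulo, uhi]` whose characteristic speed `f_u` is bounded by `M`,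
increases in `u` at a rate between `γ₁` and `γ₂`, and is Lipschitz in `k` with constant `L`; the
constant states `ulo` and `uhi` are stationary. -/
structure UniformlyConvexFlux (f : ℝ → ℝ → ℝ) (klo khi ulo uhi γ₁ γ₂ M L : ℝ) : Prop where
  gamma_pos : 0 < γ₁
  lip_nonneg : 0 ≤ L
  differentiableOn : ∀ k ∈ Set.Icc klo khi, DifferentiableOn ℝ (f k) (Set.Icc ulo uhi)
  abs_fluxDu_le : ∀ k ∈ Set.Icc klo khi, ∀ u ∈ Set.Icc ulo uhi, |fluxDu f ulo uhi k u| ≤ M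
  le_fluxDu_sub : ∀ k ∈ Set.Icc klo khi, ∀ u ∈ Set.Icc ulo uhi, ∀ w ∈ Set.Icc ulo uhi, u ≤ w →
    γ₁ * (w - u) ≤ fluxDu f ulo uhi k w - fluxDu f ulo uhi k u
  fluxDu_sub_le : ∀ k ∈ Set.Icc klo khi, ∀ u ∈ Set.Icc ulo uhi, ∀ w ∈ Set.Icc ulo uhi, u ≤ w →
    fluxDu f ulo uhi k w - fluxDu f ulo uhi k u ≤ γ₂ * (w - u)
  abs_fluxDu_sub_le_left : ∀ k₁ ∈ Set.Icc klo khi, ∀ k₂ ∈ Set.Icc klo khi, ∀ u ∈ Set.Icc ulo uhi,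
    |fluxDu f ulo uhi k₂ u - fluxDu f ulo uhi k₁ u| ≤ L * |k₂ - k₁|
  eq_at_top : ∀ k₁ ∈ Set.Icc klo khi, ∀ k₂ ∈ Set.Icc klo khi, f k₁ uhi = f k₂ uhi
  eq_at_bot : ∀ k₁ ∈ Set.Icc klo khi, ∀ k₂ ∈ Set.Icc klo khi, f k₁ ulo = f k₂ ulo

/-- The flux of the entropy `u²`, normalised to vanish at `u = ulo`. -/
def entropyFlux (f : ℝ → ℝ → ℝ) (ulo uhi k u : ℝ) : ℝ :=
  ∫ x in ulo..u, 2 * x * fluxDu f ulo uhi k x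

theorem abs_le_boundC {ulo uhi u : ℝ} (hu : u ∈ Set.Icc ulo uhi) : |u| ≤ boundC ulo uhi :=
  abs_le_max_abs_abs hu.1 hu.2

theorem abs_intervalIntegral_le_of_abs_le {g : ℝ → ℝ} {a b c C : ℝ} (hc : c ∈ Set.Icc a b)
    (hg : ∀ x ∈ Set.Icc a b, |g x| ≤ C) : |∫ x in a..c, g x| ≤ C * (b - a) := by
  have hC : 0 ≤ C := (abs_nonneg _).trans (hg c hc)
  have h := intervalIntegral.norm_integral_le_of_norm_le_const (f := g) (C := C) fun x hx =>
    hg x (Set.Icc_subset_Icc_right hc.2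
      (Set.uIcc_of_le hc.1 ▸ Set.uIoc_subset_uIcc hx : x ∈ Set.Icc a c))
  rw [abs_of_nonneg (sub_nonneg.2 hc.1)] at h
  exact h.trans (by gcongr; exact hc.2)

namespace UniformlyConvexFlux

variable {f : ℝ → ℝ → ℝ} {klo khi ulo uhi γ₁ γ₂ M L k k₁ k₂ u w : ℝ}
  (hf : UniformlyConvexFlux f klo khi ulo uhi γ₁ γ₂ M L)

include hf

theorem monotoneOn_fluxDu (hk : k ∈ Set.Icc klo khi) :
    MonotoneOn (fluxDu f ulo uhi k) (Set.Icc ulo uhi) := fun u hu w hw huw =>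
  sub_nonneg.1 ((mul_nonneg hf.gamma_pos.le (sub_nonneg.2 huw)).trans
    (hf.le_fluxDu_sub k hk u hu w hw huw))

theorem abs_fluxDu_sub_le (hk : k ∈ Set.Icc klo khi) (hu : u ∈ Set.Icc ulo uhi)
    (hw : w ∈ Set.Icc ulo uhi) :
    |fluxDu f ulo uhi k w - fluxDu f ulo uhi k u| ≤ γ₂ * |w - u| := by
  wlog huw : u ≤ w generalizing u w
  · rw [abs_sub_comm, abs_sub_comm w]
    exact this hw hu (le_of_not_ge huw)
  rw [abs_of_nonneg (sub_nonneg.2 (hf.monotoneOn_fluxDu hk hu hw huw)),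
    abs_of_nonneg (sub_nonneg.2 huw)]
  exact hf.fluxDu_sub_le k hk u hu w hw huw

theorem continuousOn_fluxDu (hk : k ∈ Set.Icc klo khi) :
    ContinuousOn (fluxDu f ulo uhi k) (Set.Icc ulo uhi) :=
  (LipschitzOnWith.of_dist_le' fun _ hx _ hy => hf.abs_fluxDu_sub_le hk hy hx).continuousOn

theorem hasDerivAt (hk : k ∈ Set.Icc klo khi) (hu : u ∈ Set.Ioo ulo uhi) :
    HasDerivAt (f k) (fluxDu f ulo uhi k u) u :=
  (hf.differentiableOn k hk u (Set.Ioo_subset_Icc_self hu)).hasDerivWithinAt.hasDerivAt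
    (Icc_mem_nhds hu.1 hu.2)

theorem exists_sub_eq_fluxDu_mul (hk : k ∈ Set.Icc klo khi) (hu : u ∈ Set.Icc ulo uhi)
    (hw : w ∈ Set.Icc ulo uhi) :
    ∃ ξ ∈ Set.uIcc u w, f k w - f k u = fluxDu f ulo uhi k ξ * (w - u) := by
  wlog huw : u ≤ w generalizing u w
  · obtain ⟨ξ, hξ, h⟩ := this hw hu (le_of_not_ge huw)
    exact ⟨ξ, Set.uIcc_comm w u ▸ hξ, by linarith⟩
  rcases huw.eq_or_lt with rfl | huw
  · exact ⟨u, Set.left_mem_uIcc, by rw [sub_self, sub_self, mul_zero]⟩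
  obtain ⟨ξ, hξ, h⟩ := exists_hasDerivAt_eq_slope (f k) (fluxDu f ulo uhi k) huw
    ((hf.differentiableOn k hk).continuousOn.mono (Set.Icc_subset_Icc hu.1 hw.2))
    fun x hx => hf.hasDerivAt hk ⟨hu.1.trans_lt hx.1, hx.2.trans_le hw.2⟩
  refine ⟨ξ, Set.uIcc_of_le huw.le ▸ Set.Ioo_subset_Icc_self hξ, ?_⟩
  rw [h, div_mul_cancel₀ _ (sub_ne_zero.2 huw.ne')]

theorem intervalIntegrable_mul_fluxDu {g : ℝ → ℝ} (hg : Continuous g) (hk : k ∈ Set.Icc klo khi)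
    (hu : u ∈ Set.Icc ulo uhi) (hw : w ∈ Set.Icc ulo uhi) :
    IntervalIntegrable (fun x => g x * fluxDu f ulo uhi k x) volume u w :=
  (hg.continuousOn.mul ((hf.continuousOn_fluxDu hk).mono
    (Set.ordConnected_Icc.uIcc_subset hu hw))).intervalIntegrable

theorem integral_fluxDu (hk : k ∈ Set.Icc klo khi) (hu : u ∈ Set.Icc ulo uhi)
    (hw : w ∈ Set.Icc ulo uhi) : ∫ x in u..w, fluxDu f ulo uhi k x = f k w - f k u := by
  have hsub := Set.ordConnected_Icc.uIcc_subset hu hw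
  refine intervalIntegral.integral_eq_sub_of_hasDeriv_right
    ((hf.differentiableOn k hk).continuousOn.mono hsub) (fun x hx => ?_)
    ((hf.continuousOn_fluxDu hk).mono hsub).intervalIntegrable
  exact (hf.hasDerivAt hk ⟨(le_min hu.1 hw.1).trans_lt hx.1,
    hx.2.trans_le (max_le hu.2 hw.2)⟩).hasDerivWithinAt

theorem abs_sub_le_of_param (hk₁ : k₁ ∈ Set.Icc klo khi) (hk₂ : k₂ ∈ Set.Icc klo khi)
    (hu : u ∈ Set.Icc ulo uhi) : |f k₂ u - f k₁ u| ≤ L * |k₂ - k₁| * (uhi - ulo) := by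
  have hlo : ulo ∈ Set.Icc ulo uhi := Set.left_mem_Icc.2 (hu.1.trans hu.2)
  have hint (k : ℝ) (hk : k ∈ Set.Icc klo khi) :
      IntervalIntegrable (fluxDu f ulo uhi k) volume ulo u := by
    simpa only [Pi.one_apply, one_mul] using
        hf.intervalIntegrable_mul_fluxDu continuous_one hk hlo hu
  have h := abs_intervalIntegral_le_of_abs_le hu
    fun x hx => hf.abs_fluxDu_sub_le_left k₁ hk₁ k₂ hk₂ x hx
  rw [intervalIntegral.integral_sub (hint _ hk₂) (hint _ hk₁), hf.integral_fluxDu hk₂ hlo hu,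
    hf.integral_fluxDu hk₁ hlo hu, hf.eq_at_bot k₂ hk₂ k₁ hk₁] at h
  simpa only [sub_sub_sub_cancel_right] using h

theorem abs_entropyFlux_le (hk : k ∈ Set.Icc klo khi) (hu : u ∈ Set.Icc ulo uhi) :
    |entropyFlux f ulo uhi k u| ≤ 2 * boundC ulo uhi * M * (uhi - ulo) :=
  abs_intervalIntegral_le_of_abs_le hu fun x hx => by
    refine abs_mul_le_mul ?_ (hf.abs_fluxDu_le k hk x hx)
    rw [abs_mul, abs_two]
    gcongr
    exact abs_le_boundC hx

theorem abs_entropyFlux_sub_le (hk₁ : k₁ ∈ Set.Icc klo khi) (hk₂ : k₂ ∈ Set.Icc klo khi)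
    (hu : u ∈ Set.Icc ulo uhi) : |entropyFlux f ulo uhi k₂ u - entropyFlux f ulo uhi k₁ u| ≤
      2 * boundC ulo uhi * (L * |k₂ - k₁|) * (uhi - ulo) := by
  have hlo : ulo ∈ Set.Icc ulo uhi := Set.left_mem_Icc.2 (hu.1.trans hu.2)
  have hint (k : ℝ) (hk : k ∈ Set.Icc klo khi) :=
    hf.intervalIntegrable_mul_fluxDu (g := fun x => 2 * x) (by fun_prop) hk hlo hu
  unfold entropyFlux
  rw [← intervalIntegral.integral_sub (hint _ hk₂) (hint _ hk₁)]
  refine abs_intervalIntegral_le_of_abs_le hu fun x hx => ?_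
  rw [← mul_sub]
  refine abs_mul_le_mul ?_ (hf.abs_fluxDu_sub_le_left k₁ hk₁ k₂ hk₂ x hx)
  rw [abs_mul, abs_two]
  gcongr
  exact abs_le_boundC hx

theorem entropyFlux_sub (hk : k ∈ Set.Icc klo khi) (hu : u ∈ Set.Icc ulo uhi)
    (hw : w ∈ Set.Icc ulo uhi) :
    entropyFlux f ulo uhi k w - entropyFlux f ulo uhi k u - (u + w) * (f k w - f k u) =
      ∫ x in u..w, (2 * x - u - w) * fluxDu f ulo uhi k x := by
  have hlo : ulo ∈ Set.Icc ulo uhi := Set.left_mem_Icc.2 (hu.1.trans hu.2)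
  have hint (v : ℝ) (hv : v ∈ Set.Icc ulo uhi) (z : ℝ) (hz : z ∈ Set.Icc ulo uhi) :=
    hf.intervalIntegrable_mul_fluxDu (g := fun x => 2 * x) (by fun_prop) hk hv hz
  unfold entropyFlux
  rw [intervalIntegral.integral_interval_sub_left (hint _ hlo _ hw) (hint _ hlo _ hu),
    ← hf.integral_fluxDu hk hu hw, ← intervalIntegral.integral_const_mul,
    ← intervalIntegral.integral_sub (hint _ hu _ hw)
      (hf.intervalIntegrable_mul_fluxDu continuous_const hk hu hw)]
  exact intervalIntegral.integral_congr fun x _ => by ring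

theorem entropy_le (hk : k ∈ Set.Icc klo khi) (hu : u ∈ Set.Icc ulo uhi)
    (hw : w ∈ Set.Icc ulo uhi) :
    -((u + w) * (f k w - f k u)) ≤ entropyFlux f ulo uhi k u - entropyFlux f ulo uhi k w
      + ((w - u)⁺ ^ 2 * (fluxDu f ulo uhi k w - fluxDu f ulo uhi k u) / 2
        - γ₁ / 6 * (w - u)⁻ ^ 3) := by
  have hflux := hf.entropyFlux_sub hk hu hw
  rcases le_total u w with h | h
  · have := integral_mul_le_of_monotoneOn h
      ((hf.monotoneOn_fluxDu hk).mono (Set.Icc_subset_Icc hu.1 hw.2))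
    rw [posPart_of_nonneg (sub_nonneg.2 h), negPart_of_nonneg (sub_nonneg.2 h)]
    linarith
  · have hsub := Set.Icc_subset_Icc hw.1 hu.2
    have := le_integral_mul_of_le_sub h ((hf.continuousOn_fluxDu hk).mono hsub)
      fun x hx y hy => hf.le_fluxDu_sub k hk x (hsub hx) y (hsub hy)
    rw [intervalIntegral.integral_symm, intervalIntegral.integral_congr
      (g := fun x => (2 * x - w - u) * fluxDu f ulo uhi k x) fun x _ => by ring] at hflux
    rw [posPart_of_nonpos (sub_nonpos.2 h), negPart_of_nonpos (sub_nonpos.2 h), neg_sub]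
    linarith

end UniformlyConvexFlux

namespace FluxHypotheses

variable {f : ℝ → ℝ → ℝ} {klo khi ulo uhi γ₁ γ₂ M k u w : ℝ}
  (hf : FluxHypotheses f klo khi ulo uhi γ₁ γ₂)

include hf

theorem hasDerivWithinAt (hk : k ∈ Set.Icc klo khi) (hu : u ∈ Set.Icc ulo uhi) :
    HasDerivWithinAt (f k) (fluxDu f ulo uhi k u) (Set.Icc ulo uhi) u :=
  ((hf.contDiffOn_u k hk).differentiableOn three_ne_zero u hu).hasDerivWithinAt

theorem hasDerivWithinAt_fluxDu (hlt : ulo < uhi) (hk : k ∈ Set.Icc klo khi)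
    (hu : u ∈ Set.Icc ulo uhi) :
    HasDerivWithinAt (fluxDu f ulo uhi k) (fluxDuu f ulo uhi k u) (Set.Icc ulo uhi) u := by
  have h := ((hf.contDiffOn_u k hk).differentiableOn_iteratedDerivWithin (m := 1)
    (by norm_num) (uniqueDiffOn_Icc hlt) u hu).hasDerivWithinAt
  rwa [← iteratedDerivWithin_succ, iteratedDerivWithin_one] at h

theorem fluxDu_sub_mem_Icc (hlt : ulo < uhi) (hk : k ∈ Set.Icc klo khi)
    (hu : u ∈ Set.Icc ulo uhi) (hw : w ∈ Set.Icc ulo uhi) (huw : u ≤ w) :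
    fluxDu f ulo uhi k w - fluxDu f ulo uhi k u ∈ Set.Icc (γ₁ * (w - u)) (γ₂ * (w - u)) := by
  rcases huw.eq_or_lt with rfl | huw
  · simp only [sub_self, mul_zero, Set.Icc_self, Set.mem_singleton_iff]
  have hderiv (x : ℝ) (hx : x ∈ Set.Icc u w) :=
    hf.hasDerivWithinAt_fluxDu hlt hk (Set.Icc_subset_Icc hu.1 hw.2 hx)
  obtain ⟨ξ, hξ, h⟩ := exists_hasDerivAt_eq_slope (fluxDu f ulo uhi k) (fluxDuu f ulo uhi k) huw
    (fun x hx => (hderiv x hx).continuousWithinAt.mono (Set.Icc_subset_Icc hu.1 hw.2))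
    fun x hx => (hderiv x (Set.Ioo_subset_Icc_self hx)).hasDerivAt
      (Icc_mem_nhds (hu.1.trans_lt hx.1) (hx.2.trans_le hw.2))
  have hξI := Set.Icc_subset_Icc hu.1 hw.2 (Set.Ioo_subset_Icc_self hξ)
  have hpos := sub_pos.2 huw
  rw [eq_div_iff hpos.ne'] at h
  rw [← h]
  exact ⟨mul_le_mul_of_nonneg_right (hf.fuu_ge k hk ξ hξI) hpos.le,
    mul_le_mul_of_nonneg_right (hf.fuu_le k hk ξ hξI) hpos.le⟩

theorem eq_affine (hlt : klo < khi) (hk : k ∈ Set.Icc klo khi) (hu : u ∈ Set.Icc ulo uhi) :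
    f k u = f klo u + (k - klo) / (khi - klo) * (f khi u - f klo u) := by
  have htaylor (x : ℝ) (hx : x ∈ Set.Icc klo khi) :
      f x u = f klo u + derivWithin (fun k => f k u) (Set.Icc klo khi) klo * (x - klo) := by
    have h := taylor_mean_remainder_bound (n := 1) hlt.le (hf.contDiffOn_k u hu) hx (C := 0)
      fun y hy => by rw [hf.fkk_eq_zero u hu y hy, norm_zero]
    rw [zero_mul, zero_div, norm_le_zero_iff, sub_eq_zero, taylorWithinEval_succ,
      taylor_within_zero_eval, iteratedDerivWithin_one] at h
    simpa [mul_comm] using h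
  rw [htaylor k hk, htaylor khi (Set.right_mem_Icc.2 hlt.le)]
  field_simp [(sub_pos.2 hlt).ne']
  ring

theorem fluxDu_eq_affine (hlt : ulo < uhi) (hlt' : klo < khi) (hk : k ∈ Set.Icc klo khi)
    (hu : u ∈ Set.Icc ulo uhi) : fluxDu f ulo uhi k u = fluxDu f ulo uhi klo u
      + (k - klo) / (khi - klo) * (fluxDu f ulo uhi khi u - fluxDu f ulo uhi klo u) := by
  have hlo := hf.hasDerivWithinAt (Set.left_mem_Icc.2 hlt'.le) hu
  have hhi := hf.hasDerivWithinAt (Set.right_mem_Icc.2 hlt'.le) hu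
  exact ((hlo.add ((hhi.sub hlo).const_mul _)).congr_of_mem
    (fun x hx => hf.eq_affine hlt' hk hx) hu).derivWithin (uniqueDiffOn_Icc hlt u hu)

theorem abs_fluxDu_sub_le_left (hlt : ulo < uhi) {k₁ k₂ : ℝ} (hk₁ : k₁ ∈ Set.Icc klo khi)
    (hk₂ : k₂ ∈ Set.Icc klo khi) (hu : u ∈ Set.Icc ulo uhi)
    (hM : ∀ k ∈ Set.Icc klo khi, ∀ u ∈ Set.Icc ulo uhi, |fluxDu f ulo uhi k u| ≤ M) :
    |fluxDu f ulo uhi k₂ u - fluxDu f ulo uhi k₁ u| ≤ 2 * M / (khi - klo) * |k₂ - k₁| := by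
  rcases (hk₁.1.trans hk₁.2).eq_or_lt with rfl | hlt'
  · rw [Set.Icc_self, Set.mem_singleton_iff] at hk₁ hk₂
    rw [hk₁, hk₂, sub_self, sub_self, abs_zero, mul_zero]
  have hpos := sub_pos.2 hlt'
  calc _ = |fluxDu f ulo uhi khi u - fluxDu f ulo uhi klo u| / (khi - klo) * |k₂ - k₁| := by
        rw [hf.fluxDu_eq_affine hlt hlt' hk₁ hu, hf.fluxDu_eq_affine hlt hlt' hk₂ hu,
          ← abs_of_pos hpos, ← abs_div, ← abs_mul, abs_of_pos hpos]
        congr 1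
        ring
    _ ≤ _ := by
        gcongr
        refine (abs_sub _ _).trans ?_
        linarith [hM khi (Set.right_mem_Icc.2 hlt'.le) u hu,
          hM klo (Set.left_mem_Icc.2 hlt'.le) u hu]

theorem uniformlyConvexFlux (hlt : ulo < uhi) (hle : klo ≤ khi)
    (hM : ∀ k ∈ Set.Icc klo khi, ∀ u ∈ Set.Icc ulo uhi, |fluxDu f ulo uhi k u| ≤ M) :
    UniformlyConvexFlux f klo khi ulo uhi γ₁ γ₂ M (2 * M / (khi - klo)) where
  gamma_pos := hf.gamma_pos
  lip_nonneg := by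
    have hM0 := (abs_nonneg _).trans
      (hM klo (Set.left_mem_Icc.2 hle) ulo (Set.left_mem_Icc.2 hlt.le))
    have := sub_nonneg.2 hle
    positivity
  differentiableOn k hk := (hf.contDiffOn_u k hk).differentiableOn three_ne_zero
  abs_fluxDu_le := hM
  le_fluxDu_sub _ hk _ hu _ hw huw := (hf.fluxDu_sub_mem_Icc hlt hk hu hw huw).1
  fluxDu_sub_le _ hk _ hu _ hw huw := (hf.fluxDu_sub_mem_Icc hlt hk hu hw huw).2
  abs_fluxDu_sub_le_left _ hk₁ _ hk₂ _ hu := hf.abs_fluxDu_sub_le_left hlt hk₁ hk₂ hu hM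
  eq_at_top := hf.eq_at_top
  eq_at_bot := hf.eq_at_bot

end FluxHypotheses

/-! ### The scheme -/

section Minmod

variable {a b c t : ℝ}

theorem sign_mul_mem_uIcc_zero (ht₀ : 0 ≤ t) (ht : t ≤ |a|) : Real.sign a * t ∈ Set.uIcc 0 a := by
  rcases lt_trichotomy a 0 with ha | rfl | ha
  · rw [abs_of_neg ha] at ht
    rw [Real.sign_of_neg ha, Set.uIcc_of_ge ha.le]
    exact ⟨by linarith, by linarith⟩
  · rw [Real.sign_zero, zero_mul]
    exact Set.left_mem_uIcc
  · rw [abs_of_pos ha] at ht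
    rw [Real.sign_of_pos ha, Set.uIcc_of_le ha.le, one_mul]
    exact ⟨ht₀, ht⟩

theorem minmod_mem_uIcc_left (a b c : ℝ) : minmod a b c ∈ Set.uIcc 0 a := by
  unfold minmod
  split_ifs with h
  · exact sign_mul_mem_uIcc_zero (by positivity) (min_le_left _ _)
  · exact Set.left_mem_uIcc

theorem minmod_mem_uIcc_right (a b c : ℝ) : minmod a b c ∈ Set.uIcc 0 c := by
  unfold minmod
  split_ifs with h
  · rw [h.1.trans h.2]
    exact sign_mul_mem_uIcc_zero (by positivity) ((min_le_right _ _).trans (min_le_right _ _))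
  · exact Set.left_mem_uIcc

theorem realSign_nonpos (ha : a ≤ 0) : Real.sign a ≤ 0 := by
  rcases ha.eq_or_lt with rfl | ha
  · exact Real.sign_zero.le
  · rw [Real.sign_of_neg ha]
    exact neg_one_lt_zero.le

theorem minmod_nonpos (h : min a (min b c) ≤ 0) : minmod a b c ≤ 0 := by
  unfold minmod
  split_ifs with hs
  · refine mul_nonpos_of_nonpos_of_nonneg ?_ (by positivity)
    rw [min_le_iff, min_le_iff] at h
    rcases h with h | h | h
    · exact realSign_nonpos h
    · exact hs.1 ▸ realSign_nonpos h
    · exact hs.1.trans hs.2 ▸ realSign_nonpos h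
  · rfl

theorem posPart_minmod (a b c : ℝ) : (minmod a b c)⁺ = (min a (min b c))⁺ := by
  rcases le_or_gt (min a (min b c)) 0 with h | h
  · rw [posPart_of_nonpos (minmod_nonpos h), posPart_of_nonpos h]
  · obtain ⟨ha, hb, hc⟩ : 0 < a ∧ 0 < b ∧ 0 < c := by simpa only [lt_min_iff] using h
    rw [minmod, Real.sign_of_pos ha, Real.sign_of_pos hb, Real.sign_of_pos hc,
      if_pos ⟨rfl, rfl⟩, abs_of_pos ha, abs_of_pos hb, abs_of_pos hc, one_mul]

end Minmod

theorem slope_mem_uIcc (v : ℤ → ℝ) (m : ℤ) : slope v m ∈ Set.uIcc 0 (v (m + 2) - v m) :=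
  minmod_mem_uIcc_left _ _ _

theorem slope_succ_mem_uIcc (v : ℤ → ℝ) (m : ℤ) :
    slope v (m + 2) ∈ Set.uIcc 0 (v (m + 2) - v m) := by
  rw [slope, add_sub_cancel_right]
  exact minmod_mem_uIcc_right _ _ _

theorem posPart_slope_succ (v : ℤ → ℝ) (m : ℤ) :
    (slope v (m + 2))⁺ = min (v (m + 2) - v m)⁺ (v (m + 2 + 2) - v (m + 2))⁺ := by
  unfold slope
  rw [posPart_minmod, ← posPart_min, add_sub_cancel_right]
  congr 1
  -- The central difference is the mean of the one-sided ones, so it never is the smallest.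
  rcases le_total (v (m + 2) - v m) (v (m + 2 + 2) - v (m + 2)) with h | h
  · rw [min_eq_left h, min_eq_right (by linarith : v (m + 2) - v m ≤ _), min_eq_right h]
  · rw [min_eq_right h, min_eq_left]
    exact le_min (by linarith) h

theorem mem_of_abs_sub_le_abs {I : Set ℝ} [hI : I.OrdConnected] {x y s : ℝ}
    (hadd : x + s ∈ I) (hsub : x - s ∈ I) (h : |y - x| ≤ |s|) : y ∈ I := by
  refine hI.uIcc_subset hsub hadd (Set.mem_uIcc.2 ?_)
  rcases le_total 0 s with hs | hs
  · rw [abs_of_nonneg hs, abs_le] at h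
    exact Or.inl ⟨by linarith, by linarith⟩
  · rw [abs_of_nonpos hs, abs_le] at h
    exact Or.inr ⟨by linarith, by linarith⟩

theorem add_slope_mem {I : Set ℝ} [hI : I.OrdConnected] {v : ℤ → ℝ} (hv : ∀ m, v m ∈ I) (m : ℤ) :
    v m + slope v m ∈ I := by
  refine hI.uIcc_subset (hv m) (hv (m + 2)) ?_
  have h := Set.mem_image_of_mem (v m + ·) (slope_mem_uIcc v m)
  simpa [Set.image_const_add_uIcc] using h

theorem sub_slope_mem {I : Set ℝ} [hI : I.OrdConnected] {v : ℤ → ℝ} (hv : ∀ m, v m ∈ I) (m : ℤ) :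
    v m - slope v m ∈ I := by
  refine hI.uIcc_subset (hv m) (hv (m - 2)) ?_
  have h := Set.mem_image_of_mem (v m - ·) (slope_succ_mem_uIcc v (m - 2))
  simpa [Set.image_const_sub_uIcc] using h

namespace UniformlyConvexFlux

variable {f : ℝ → ℝ → ℝ} {klo khi ulo uhi γ₁ γ₂ M L lam : ℝ} {K u : ℤ → ℝ}
  (hf : UniformlyConvexFlux f klo khi ulo uhi γ₁ γ₂ M L) (hlam : 0 ≤ lam)
  (hK : ∀ m, K m ∈ Set.Icc klo khi) (hu : ∀ m, u m ∈ Set.Icc ulo uhi)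

include hf hlam

theorem abs_mul_fluxDu_le {k w : ℝ} (hk : k ∈ Set.Icc klo khi) (hw : w ∈ Set.Icc ulo uhi) :
    |lam * fluxDu f ulo uhi k w| ≤ lam * M := by
  rw [abs_mul, abs_of_nonneg hlam]
  exact mul_le_mul_of_nonneg_left (hf.abs_fluxDu_le k hk w hw) hlam

theorem abs_mul_fluxDu_sub_le {k v w : ℝ} (hk : k ∈ Set.Icc klo khi) (hv : v ∈ Set.Icc ulo uhi)
    (hw : w ∈ Set.Icc ulo uhi) :
    |lam * fluxDu f ulo uhi k w - lam * fluxDu f ulo uhi k v| ≤ lam * γ₂ * |w - v| := by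
  rw [← mul_sub, abs_mul, abs_of_nonneg hlam, mul_assoc]
  exact mul_le_mul_of_nonneg_left (hf.abs_fluxDu_sub_le hk hv hw) hlam

theorem abs_mul_flux_sub_le {k v w : ℝ} (hk : k ∈ Set.Icc klo khi) (hv : v ∈ Set.Icc ulo uhi)
    (hw : w ∈ Set.Icc ulo uhi) : |lam * (f k w - f k v)| ≤ lam * M * |w - v| := by
  obtain ⟨ξ, hξ, h⟩ := hf.exists_sub_eq_fluxDu_mul hk hv hw
  rw [h, ← mul_assoc, abs_mul]
  gcongr
  exact hf.abs_mul_fluxDu_le hlam hk (Set.ordConnected_Icc.uIcc_subset hv hw hξ)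

include hK hu

theorem abs_midValue_sub_le (m : ℤ) :
    |midValue f ulo uhi lam K u m - u m| ≤ lam * M / 2 * |slope u m| := by
  rw [midValue, sub_sub_cancel_left, abs_neg, div_mul_eq_mul_div, abs_mul, abs_div, abs_two]
  gcongr
  exact hf.abs_mul_fluxDu_le hlam (hK m) (hu m)

theorem midValue_mem (hM : lam * M ≤ 2) (m : ℤ) :
    midValue f ulo uhi lam K u m ∈ Set.Icc ulo uhi :=
  mem_of_abs_sub_le_abs (add_slope_mem hu m) (sub_slope_mem hu m)
    ((hf.abs_midValue_sub_le hlam hK hu m).trans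
      (mul_le_of_le_one_left (abs_nonneg _) (by linarith)))

theorem abs_mul_flux_midValue_sub_le (hM : lam * M ≤ 1 / 4) {w : ℝ} (hw : w ∈ Set.Icc ulo uhi)
    {m : ℤ} {δ : ℝ} (hδ : |slope u m| ≤ δ) :
    |lam * (f (K m) (midValue f ulo uhi lam K u m) - f (K m) w)| ≤ δ / 32 + |u m - w| / 4 := by
  have : 0 ≤ lam * M := (abs_nonneg _).trans (hf.abs_mul_fluxDu_le hlam (hK m) hw)
  calc _ ≤ lam * M * |midValue f ulo uhi lam K u m - w| :=
        hf.abs_mul_flux_sub_le hlam (hK m) hw (hf.midValue_mem hlam hK hu (by linarith) m)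
    _ ≤ 1 / 4 * (1 / 4 / 2 * δ + |u m - w|) := by
        gcongr
        refine (abs_sub_le _ (u m) _).trans (add_le_add_left ?_ _)
        refine (hf.abs_midValue_sub_le hlam hK hu m).trans ?_
        gcongr
    _ = δ / 32 + |u m - w| / 4 := by ring

theorem abs_step_sub_average_le (hM : lam * M ≤ 1 / 4) {w : ℝ} (hw : w ∈ Set.Icc ulo uhi)
    (hstat : ∀ k₁ ∈ Set.Icc klo khi, ∀ k₂ ∈ Set.Icc klo khi, f k₁ w = f k₂ w) (m : ℤ) :
    |step f ulo uhi lam K u (m + 1) - (u m + u (m + 2)) / 2| ≤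
      (|u m - w| + |u (m + 2) - w|) / 2 := by
  have hjump : |u (m + 2) - u m| ≤ |u (m + 2) - w| + |u m - w| := by
    rw [abs_sub_comm (u m) w]
    exact abs_sub_le _ _ _
  have hslope := slope_mem_uIcc u m
  have hslope' := slope_succ_mem_uIcc u m
  have hdiff := abs_sub_le_of_mem_uIcc_zero hslope hslope'
  have hflux := hf.abs_mul_flux_midValue_sub_le hlam hK hu hM hw
    (abs_le_abs_of_mem_uIcc_zero hslope)
  have hflux' := hf.abs_mul_flux_midValue_sub_le hlam hK hu hM hw
    (abs_le_abs_of_mem_uIcc_zero hslope')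
  rw [hstat _ (hK (m + 2)) _ (hK m)] at hflux'
  rw [step, add_sub_cancel_right, add_assoc, one_add_one_eq_two]
  rw [abs_le] at hdiff hflux hflux' ⊢
  constructor <;> linarith

theorem step_mem (hM : lam * M ≤ 1 / 4) (m : ℤ) :
    step f ulo uhi lam K u m ∈ Set.Icc ulo uhi := by
  have hle := (hu m).1.trans (hu m).2
  have hlo := hf.abs_step_sub_average_le hlam hK hu hM (Set.left_mem_Icc.2 hle) hf.eq_at_bot (m - 1)
  have hhi := hf.abs_step_sub_average_le hlam hK hu hM (Set.right_mem_Icc.2 hle) hf.eq_at_top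
    (m - 1)
  rw [sub_add_cancel, abs_of_nonneg (sub_nonneg.2 (hu _).1),
    abs_of_nonneg (sub_nonneg.2 (hu _).1), abs_le] at hlo
  rw [sub_add_cancel, abs_of_nonpos (sub_nonpos.2 (hu _).2),
    abs_of_nonpos (sub_nonpos.2 (hu _).2), abs_le] at hhi
  exact ⟨by linarith, by linarith⟩

end UniformlyConvexFlux

namespace UniformlyConvexFlux

variable {f : ℝ → ℝ → ℝ} {klo khi ulo uhi γ₁ γ₂ M L lam : ℝ}
  (hf : UniformlyConvexFlux f klo khi ulo uhi γ₁ γ₂ M L)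

include hf

section Constants

variable (hne : (Set.Icc klo khi).Nonempty) (hlt : ulo < uhi)

include hne hlt

theorem gamma_le : γ₁ ≤ γ₂ := by
  obtain ⟨k, hk⟩ := hne
  have hlo := Set.left_mem_Icc.2 hlt.le
  have hhi := Set.right_mem_Icc.2 hlt.le
  exact le_of_mul_le_mul_right ((hf.le_fluxDu_sub k hk _ hlo _ hhi hlt.le).trans
    (hf.fluxDu_sub_le k hk _ hlo _ hhi hlt.le)) (sub_pos.2 hlt)

theorem gamma_mul_le : γ₁ * (uhi - ulo) ≤ 2 * M := by
  obtain ⟨k, hk⟩ := hne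
  have hlo := Set.left_mem_Icc.2 hlt.le
  have hhi := Set.right_mem_Icc.2 hlt.le
  linarith [hf.le_fluxDu_sub k hk _ hlo _ hhi hlt.le, le_of_abs_le (hf.abs_fluxDu_le k hk _ hhi),
    neg_le_of_abs_le (hf.abs_fluxDu_le k hk _ hlo)]

theorem gamma₂_pos : 0 < γ₂ :=
  hf.gamma_pos.trans_le (hf.gamma_le hne hlt)

theorem mul_M_mul_le (hlam : 0 ≤ lam) (hcfl : lam * M ≤ γ₁ / (7500 * γ₂)) :
    lam * M * (lam * γ₂) ≤ lam * γ₁ / 7500 := by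
  rw [le_div_iff₀ (mul_pos (by norm_num) (hf.gamma₂_pos hne hlt))] at hcfl
  linarith [mul_le_mul_of_nonneg_left hcfl hlam]

theorem mul_M_le (hcfl : lam * M ≤ γ₁ / (7500 * γ₂)) : lam * M ≤ 1 / 7500 := by
  have hγ₂ := hf.gamma₂_pos hne hlt
  refine hcfl.trans ((div_le_div_iff₀ (by positivity) (by norm_num)).2 ?_)
  linarith [hf.gamma_le hne hlt]

theorem mul_gamma_mul_le (hlam : 0 ≤ lam) (hcfl : lam * M ≤ γ₁ / (7500 * γ₂)) :
    lam * γ₂ * (uhi - ulo) ≤ 1 := by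
  have hγ₂ := hf.gamma₂_pos hne hlt
  rw [le_div_iff₀ (by positivity)] at hcfl
  refine le_of_mul_le_mul_left ?_ hf.gamma_pos
  calc γ₁ * (lam * γ₂ * (uhi - ulo)) = lam * γ₂ * (γ₁ * (uhi - ulo)) := by ring
    _ ≤ lam * γ₂ * (2 * M) :=
        mul_le_mul_of_nonneg_left (hf.gamma_mul_le hne hlt) (by positivity)
    _ ≤ γ₁ * 1 := by linarith [hf.gamma_pos]

end Constants

variable {K u : ℤ → ℝ} (hK : ∀ m, K m ∈ Set.Icc klo khi) (hu : ∀ m, u m ∈ Set.Icc ulo uhi)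
  (hlam : 0 ≤ lam)

include hlam hK hu

theorem abs_slopeFlux_add_le (hlt : ulo < uhi) (hM : lam * M ≤ 2) (m : ℤ) :
    |lam * (f (K m) (midValue f ulo uhi lam K u m) - f (K m) (u m))
        + (lam * fluxDu f ulo uhi (K m) (u m)) ^ 2 * slope u m / 2| ≤
      lam * γ₂ * (lam * M) ^ 2 * slope u m ^ 2 / 4 := by
  have hmem := hf.midValue_mem hlam hK hu hM m
  obtain ⟨ξ, hξ, hslope⟩ := hf.exists_sub_eq_fluxDu_mul (hK m) (hu m) hmem
  have hξI := Set.ordConnected_Icc.uIcc_subset (hu m) hmem hξ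
  have : 0 ≤ lam * M := (abs_nonneg _).trans (hf.abs_mul_fluxDu_le hlam (hK m) (hu m))
  set ν := lam * fluxDu f ulo uhi (K m) (u m) with hν
  have hmid : midValue f ulo uhi lam K u m - u m = -(ν * slope u m / 2) := by
    rw [midValue, hν]
    ring
  have hνσ : |ν * slope u m / 2| ≤ lam * M / 2 * |slope u m| := by
    rw [← abs_neg, ← hmid]
    exact hf.abs_midValue_sub_le hlam hK hu m
  have hνξ : |lam * fluxDu f ulo uhi (K m) ξ - ν| ≤
      lam * γ₂ * (lam * M / 2 * |slope u m|) := by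
    have hγ₂ := hf.gamma₂_pos ⟨_, hK m⟩ hlt
    refine (hf.abs_mul_fluxDu_sub_le hlam (hK m) (hu m) hξI).trans ?_
    gcongr
    exact (Set.abs_sub_left_of_mem_uIcc hξ).trans (hf.abs_midValue_sub_le hlam hK hu m)
  calc _ = |ν * slope u m / 2 * (lam * fluxDu f ulo uhi (K m) ξ - ν)| := by
        rw [hslope, hmid, ← abs_neg]
        congr 1
        ring
    _ ≤ _ := abs_mul_le_mul hνσ hνξ
    _ = lam * γ₂ * (lam * M) ^ 2 * slope u m ^ 2 / 4 := by
        rw [← sq_abs (slope u m)]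
        ring

end UniformlyConvexFlux

/-- A common Lipschitz constant, as functions of the coefficient `k`, of the characteristic speed,
the flux and the entropy flux, each multiplied by `lam`. -/
def coeffLipschitzConst (ulo uhi lam L : ℝ) : ℝ :=
  lam * L * (1 + (1 + 2 * boundC ulo uhi) * (uhi - ulo))

theorem abs_mul_le_coeffLipschitzConst_mul {ulo uhi lam L x δ c : ℝ} (hlam : 0 ≤ lam) (hL : 0 ≤ L)
    (hx : |x| ≤ L * |δ| * c) (hc : c ≤ 1 + (1 + 2 * boundC ulo uhi) * (uhi - ulo)) :
    |lam * x| ≤ coeffLipschitzConst ulo uhi lam L * |δ| := by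
  rw [abs_mul, abs_of_nonneg hlam]
  calc lam * |x| ≤ lam * (L * |δ| * (1 + (1 + 2 * boundC ulo uhi) * (uhi - ulo))) := by
        refine mul_le_mul_of_nonneg_left (hx.trans ?_) hlam
        gcongr
    _ = coeffLipschitzConst ulo uhi lam L * |δ| := by
        rw [coeffLipschitzConst]
        ring

theorem boundC_nonneg (ulo uhi : ℝ) : 0 ≤ boundC ulo uhi :=
  (abs_nonneg ulo).trans (le_max_left _ _)

namespace UniformlyConvexFlux

variable {f : ℝ → ℝ → ℝ} {klo khi ulo uhi γ₁ γ₂ M L lam : ℝ}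
  (hf : UniformlyConvexFlux f klo khi ulo uhi γ₁ γ₂ M L) (hlam : 0 ≤ lam)

include hf hlam

section Coefficient

variable {k₁ k₂ u w : ℝ} (hk₁ : k₁ ∈ Set.Icc klo khi) (hk₂ : k₂ ∈ Set.Icc klo khi)
  (hw : w ∈ Set.Icc ulo uhi)

include hk₁ hk₂ hw

theorem abs_mul_fluxDu_sub_le_left : |lam * fluxDu f ulo uhi k₂ w - lam * fluxDu f ulo uhi k₁ w| ≤
    coeffLipschitzConst ulo uhi lam L * |k₂ - k₁| := by
  have := mul_nonneg (boundC_nonneg ulo uhi) (sub_nonneg.2 (hw.1.trans hw.2))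
  rw [← mul_sub]
  refine abs_mul_le_coeffLipschitzConst_mul hlam hf.lip_nonneg (c := 1) ?_
    (by linarith [hw.1, hw.2])
  rw [mul_one]
  exact hf.abs_fluxDu_sub_le_left k₁ hk₁ k₂ hk₂ w hw

theorem abs_mul_sub_le_of_param :
    |lam * (f k₂ w - f k₁ w)| ≤ coeffLipschitzConst ulo uhi lam L * |k₂ - k₁| := by
  have := mul_nonneg (boundC_nonneg ulo uhi) (sub_nonneg.2 (hw.1.trans hw.2))
  exact abs_mul_le_coeffLipschitzConst_mul hlam hf.lip_nonneg
    (hf.abs_sub_le_of_param hk₁ hk₂ hw) (by linarith)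

theorem abs_mul_entropyFlux_sub_le :
    |lam * (entropyFlux f ulo uhi k₂ w - entropyFlux f ulo uhi k₁ w)| ≤
      coeffLipschitzConst ulo uhi lam L * |k₂ - k₁| := by
  refine abs_mul_le_coeffLipschitzConst_mul hlam hf.lip_nonneg
    (c := 2 * boundC ulo uhi * (uhi - ulo)) ?_ (by linarith [hw.1, hw.2])
  linarith [hf.abs_entropyFlux_sub_le hk₁ hk₂ hw]

theorem mul_entropy_le (hu : u ∈ Set.Icc ulo uhi) :
    -((u + w) * (lam * (f k₁ w - f k₁ u))) ≤
      lam * entropyFlux f ulo uhi k₁ u - lam * entropyFlux f ulo uhi k₂ w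
        + ((w - u)⁺ ^ 2 * (lam * fluxDu f ulo uhi k₁ w - lam * fluxDu f ulo uhi k₁ u) / 2
          - lam * γ₁ / 6 * (w - u)⁻ ^ 3)
        + coeffLipschitzConst ulo uhi lam L * |k₂ - k₁| := by
  have hcoeff := le_of_abs_le (hf.abs_mul_entropyFlux_sub_le hlam hk₁ hk₂ hw)
  linarith [mul_le_mul_of_nonneg_left (hf.entropy_le hk₁ hu hw) hlam]

end Coefficient

theorem exists_staggeredStep {K u : ℤ → ℝ} (hK : ∀ m, K m ∈ Set.Icc klo khi)
    (hu : ∀ m, u m ∈ Set.Icc ulo uhi) (hlt : ulo < uhi) (hcfl : lam * M ≤ γ₁ / (7500 * γ₂)) :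
    ∃ S : StaggeredStep (lam * M) (lam * γ₁) (lam * γ₂) (boundC ulo uhi)
        (lam * (2 * boundC ulo uhi * M * (uhi - ulo))),
      S.u = u ∧ S.v = step f ulo uhi lam K u ∧
        S.e = fun m => coeffLipschitzConst ulo uhi lam L * |K (m + 2) - K m| := by
  have hne : (Set.Icc klo khi).Nonempty := ⟨K 0, hK 0⟩
  have hγ₂ := hf.gamma₂_pos hne hlt
  have hM := hf.mul_M_le hne hlt hcfl
  choose ξ hξ hslope using fun m => hf.exists_sub_eq_fluxDu_mul (hK m) (hu m) (hu (m + 2))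
  have hξI (m : ℤ) := Set.ordConnected_Icc.uIcc_subset (hu m) (hu (m + 2)) (hξ m)
  have hchord (m : ℤ) : lam * fluxDu f ulo uhi (K m) (ξ m) * (u (m + 2) - u m) =
      lam * (f (K m) (u (m + 2)) - f (K m) (u m)) := by rw [mul_assoc, hslope]
  refine ⟨{
    u := u
    v := step f ulo uhi lam K u
    σ := slope u
    r := fun m => lam * (f (K m) (midValue f ulo uhi lam K u m) - f (K m) (u m))
    ν := fun m => lam * fluxDu f ulo uhi (K m) (u m)
    ν' := fun m => lam * fluxDu f ulo uhi (K m) (u (m + 2))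
    μ := fun m => lam * fluxDu f ulo uhi (K m) (ξ m)
    q := fun m => lam * entropyFlux f ulo uhi (K m) (u m)
    e := fun m => coeffLipschitzConst ulo uhi lam L * |K (m + 2) - K m|
    ε := fun m => lam * (f (K (m + 2)) (u (m + 2)) - f (K m) (u (m + 2)))
    κ_nonneg := (abs_nonneg _).trans (hf.abs_mul_fluxDu_le hlam (hK 0) (hu 0))
    κ_le := hM
    κ_mul_le := hf.mul_M_mul_le hne hlt hlam hcfl
    ℓ₂_nonneg := by positivity
    ℓ₂_mul_le := fun m => (mul_le_mul_of_nonneg_left (Real.dist_le_of_mem_Icc (hu _) (hu _))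
      (by positivity)).trans (hf.mul_gamma_mul_le hne hlt hlam hcfl)
    abs_u_le := fun m => abs_le_boundC (hu m)
    abs_v_le := fun m => abs_le_boundC (hf.step_mem hlam hK hu (by linarith) m)
    σ_mem := slope_mem_uIcc u
    σ_succ_mem := slope_succ_mem_uIcc u
    posPart_σ_succ := posPart_slope_succ u
    abs_ν_le := fun m => hf.abs_mul_fluxDu_le hlam (hK m) (hu m)
    abs_ν'_le := fun m => hf.abs_mul_fluxDu_le hlam (hK m) (hu (m + 2))
    abs_μ_le := fun m => hf.abs_mul_fluxDu_le hlam (hK m) (hξI m)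
    abs_r_add_le := hf.abs_slopeFlux_add_le hK hu hlam hlt (by linarith)
    abs_μ_sub_ν_le := fun m => (hf.abs_mul_fluxDu_sub_le hlam (hK m) (hu m) (hξI m)).trans
      (mul_le_mul_of_nonneg_left (Set.abs_sub_left_of_mem_uIcc (hξ m)) (by positivity))
    abs_ν'_sub_μ_le := fun m =>
      (hf.abs_mul_fluxDu_sub_le hlam (hK m) (hξI m) (hu (m + 2))).trans
        (mul_le_mul_of_nonneg_left (Set.abs_sub_right_of_mem_uIcc (hξ m)) (by positivity))
    le_ν'_sub_ν := fun m h => by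
      rw [← mul_sub, mul_assoc]
      exact mul_le_mul_of_nonneg_left
        (hf.le_fluxDu_sub _ (hK m) _ (hu m) _ (hu (m + 2)) (sub_nonneg.1 h)) hlam
    e_nonneg := fun m => (abs_nonneg _).trans
      (hf.abs_mul_sub_le_of_param hlam (hK m) (hK (m + 2)) (hu m))
    abs_ν_succ_sub_ν'_le := fun m =>
      hf.abs_mul_fluxDu_sub_le_left hlam (hK m) (hK (m + 2)) (hu (m + 2))
    abs_ε_le := fun m => hf.abs_mul_sub_le_of_param hlam (hK m) (hK (m + 2)) (hu (m + 2))
    abs_q_le := fun m => by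
      rw [abs_mul, abs_of_nonneg hlam]
      exact mul_le_mul_of_nonneg_left (hf.abs_entropyFlux_le (hK m) (hu m)) hlam
    entropy_le := fun m => by
      rw [hchord]
      exact hf.mul_entropy_le hlam (hK m) (hK (m + 2)) (hu (m + 2)) (hu m)
    v_eq := fun m => by
      rw [hchord, step, add_sub_cancel_right, add_assoc m, one_add_one_eq_two]
      ring }, rfl, rfl, rfl⟩

theorem approx_mem {k u₀ : ℝ → ℝ} {Δx : ℝ} (hM : lam * M ≤ 1 / 4)
    (hK : ∀ m, cellAverage k Δx m ∈ Set.Icc klo khi)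
    (hu₀ : ∀ m, cellAverage u₀ Δx m ∈ Set.Icc ulo uhi) (n : ℕ) :
    ∀ m, approx f ulo uhi lam k u₀ Δx n m ∈ Set.Icc ulo uhi := by
  induction n with
  | zero => exact hu₀
  | succ n ih => exact hf.step_mem hlam hK ih hM

end UniformlyConvexFlux

/-! ### Cell averages -/

section CellAverage

variable {g p q : ℝ → ℝ} {Δx : ℝ}

/-- The cell of length `Δx` centred at `x_{m/2}`. -/
def cell (Δx : ℝ) (m : ℤ) : Set ℝ :=
  Set.Ioc (((m : ℝ) - 1) / 2 * Δx) (((m : ℝ) + 1) / 2 * Δx)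

theorem volume_cell (Δx : ℝ) (m : ℤ) : volume (cell Δx m) = ENNReal.ofReal Δx := by
  rw [cell, Real.volume_Ioc]
  congr 1
  ring

theorem cellAverage_eq_setAverage (g : ℝ → ℝ) (hΔx : 0 < Δx) (m : ℤ) :
    cellAverage g Δx m = ⨍ x in cell Δx m, g x := by
  rw [setAverage_eq, measureReal_def, volume_cell, ENNReal.toReal_ofReal hΔx.le, cellAverage,
    intervalIntegral.integral_of_le (by gcongr; linarith), one_div, smul_eq_mul, cell]

theorem cellAverage_mem {s : Set ℝ} (hs : Convex ℝ s) (hsc : IsClosed s) (hΔx : 0 < Δx) {m : ℤ}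
    (hgs : ∀ᵐ x ∂volume.restrict (cell Δx m), g x ∈ s) (hg : IntegrableOn g (cell Δx m)) :
    cellAverage g Δx m ∈ s := by
  rw [cellAverage_eq_setAverage g hΔx]
  refine hs.set_average_mem hsc ?_ ?_ hgs hg <;> rw [volume_cell]
  · exact (ENNReal.ofReal_pos.2 hΔx).ne'
  · exact ENNReal.ofReal_ne_top

theorem cellAverage_mem_Icc {lo hi : ℝ} (hg : AEStronglyMeasurable g)
    (hrange : ∀ᵐ x, g x ∈ Set.Icc lo hi) (hΔx : 0 < Δx) (m : ℤ) :
    cellAverage g Δx m ∈ Set.Icc lo hi := by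
  refine cellAverage_mem (convex_Icc lo hi) isClosed_Icc hΔx (ae_restrict_of_ae hrange)
    (Measure.integrableOn_of_bounded (volume_cell Δx m ▸ ENNReal.ofReal_ne_top) hg
      (M := max |lo| |hi|) (ae_restrict_of_ae ?_))
  exact hrange.mono fun x hx => abs_le_max_abs_abs hx.1 hx.2

theorem integrableOn_cell (hp : Monotone p) (Δx : ℝ) (m : ℤ) : IntegrableOn p (cell Δx m) :=
  (hp.locallyIntegrable.integrableOn_isCompact isCompact_Icc).mono_set Set.Ioc_subset_Icc_self

theorem cellAverage_le_cellAverage_add_two (hp : Monotone p) (hΔx : 0 < Δx) (m : ℤ) :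
    cellAverage p Δx m ≤ cellAverage p Δx (m + 2) := by
  have hle : cellAverage p Δx m ∈ Set.Iic (p (((m : ℝ) + 1) / 2 * Δx)) :=
    cellAverage_mem (convex_Iic _) isClosed_Iic hΔx
      (ae_restrict_of_forall_mem measurableSet_Ioc fun x hx => hp hx.2)
      (integrableOn_cell hp Δx m)
  refine hle.trans (cellAverage_mem (convex_Ici _) isClosed_Ici hΔx
    (ae_restrict_of_forall_mem measurableSet_Ioc fun x hx => hp ?_)
    (integrableOn_cell hp Δx (m + 2)))
  refine le_trans (le_of_eq ?_) hx.1.le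
  push_cast
  ring

theorem cellAverage_sub (hp : Monotone p) (hq : Monotone q) (Δx : ℝ) (m : ℤ) :
    cellAverage (p - q) Δx m = cellAverage p Δx m - cellAverage q Δx m := by
  unfold cellAverage
  rw [← mul_sub, ← intervalIntegral.integral_sub hp.intervalIntegrable hq.intervalIntegrable]
  rfl

theorem cellAverage_congr_ae (h : p =ᵐ[volume] q) (Δx : ℝ) :
    cellAverage p Δx = cellAverage q Δx := by
  funext m
  unfold cellAverage
  rw [intervalIntegral.integral_congr_ae (h.mono fun x hx _ => hx)]

theorem exists_monotone_sub_monotone_of_boundedVariationOn {v : ℝ → ℝ}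
    (hv : BoundedVariationOn v Set.univ) : ∃ p q : ℝ → ℝ, ∃ C : ℝ, Monotone p ∧ Monotone q ∧
      (∀ x, |p x| ≤ C) ∧ (∀ x, |q x| ≤ C) ∧ v = p - q := by
  set W := (eVariationOn v Set.univ).toReal
  set p := variationOnFromTo v Set.univ 0
  have hloc := hv.locallyBoundedVariationOn
  have hp (x : ℝ) : |p x| ≤ W := variationOnFromTo.abs_le_eVariationOn hv
  have hv_le (x : ℝ) : |v x| ≤ W + |v 0| := by
    have := abs_sub_abs_le_abs_sub (v x) (v 0)
    linarith [hv.dist_le (Set.mem_univ x) (Set.mem_univ 0), Real.dist_eq (v x) (v 0)]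
  refine ⟨p, p - v, W + (W + |v 0|),
    monotoneOn_univ.1 (variationOnFromTo.monotoneOn hloc (Set.mem_univ 0)),
    monotoneOn_univ.1 (variationOnFromTo.sub_self_monotoneOn hloc (Set.mem_univ 0)),
    fun x => (hp x).trans (le_add_of_nonneg_right ((abs_nonneg _).trans (hv_le x))),
    fun x => (abs_sub _ _).trans (add_le_add (hp x) (hv_le x)), (sub_sub_cancel p v).symm⟩

theorem sum_range_sub_le_of_abs_le {P : ℤ → ℝ} {C : ℝ} (hP : ∀ m, |P m| ≤ C) (b : ℤ) (L : ℕ) :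
    ∑ t ∈ Finset.range L, (P (b + t + 2) - P (b + t)) ≤ 4 * C := by
  calc _ = ∑ t ∈ Finset.range L, ((P (b + ↑(t + 1) + 1) + P (b + ↑(t + 1)))
        - (P (b + t + 1) + P (b + t))) := Finset.sum_congr rfl fun t _ => by
        push_cast
        rw [← add_assoc, add_assoc (b + t), one_add_one_eq_two]
        ring
    _ = (P (b + L + 1) + P (b + L)) - (P (b + (0 : ℕ) + 1) + P (b + (0 : ℕ))) :=
        Finset.sum_range_sub (fun t : ℕ => P (b + t + 1) + P (b + t)) L
    _ ≤ 4 * C := by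
        linarith [le_of_abs_le (hP (b + L + 1)), le_of_abs_le (hP (b + L)),
          neg_le_of_abs_le (hP (b + (0 : ℕ) + 1)), neg_le_of_abs_le (hP (b + (0 : ℕ)))]

theorem sum_cellAverage_sub_le {C : ℝ} (hp : Monotone p) (hC : ∀ x, |p x| ≤ C) (hΔx : 0 < Δx)
    (b : ℤ) (L : ℕ) :
    ∑ t ∈ Finset.range L, (cellAverage p Δx (b + t + 2) - cellAverage p Δx (b + t)) ≤ 4 * C :=
  sum_range_sub_le_of_abs_le (fun m => abs_le.2 (cellAverage_mem_Icc
    hp.measurable.aestronglyMeasurable (.of_forall fun x => abs_le.1 (hC x)) hΔx m)) b L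

theorem MemLinftyBV.exists_sum_abs_cellAverage_sub_le (hg : MemLinftyBV g) :
    ∃ V : ℝ, ∀ Δx : ℝ, 0 < Δx → ∀ (b : ℤ) (L : ℕ), ∑ t ∈ Finset.range L,
      |cellAverage g Δx (b + t + 2) - cellAverage g Δx (b + t)| ≤ V := by
  obtain ⟨-, v, hgv, hv⟩ := hg
  obtain ⟨p, q, C, hp, hq, hpC, hqC, rfl⟩ := exists_monotone_sub_monotone_of_boundedVariationOn hv
  refine ⟨4 * C + 4 * C, fun Δx hΔx b L => ?_⟩
  refine le_trans ?_ (add_le_add (sum_cellAverage_sub_le hp hpC hΔx b L)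
    (sum_cellAverage_sub_le hq hqC hΔx b L))
  rw [← Finset.sum_add_distrib, cellAverage_congr_ae hgv]
  refine Finset.sum_le_sum fun t _ => ?_
  rw [cellAverage_sub hp hq, cellAverage_sub hp hq, sub_sub_sub_comm]
  refine (abs_sub _ _).trans_eq ?_
  rw [abs_of_nonneg (sub_nonneg.2 (cellAverage_le_cellAverage_add_two hp hΔx _)),
    abs_of_nonneg (sub_nonneg.2 (cellAverage_le_cellAverage_add_two hq hΔx _))]

end CellAverage

/-! ### The cubic estimate -/

theorem cubicSum_le (u : ℕ → ℤ → ℝ) (N J : ℕ) :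
    cubicSum u N J ≤ ∑ n ∈ Finset.range N, ∑ t ∈ Finset.range (4 * J + 1),
      |u n (-(2 * J) + t + 2) - u n (-(2 * J) + t)| ^ 3 := by
  refine Finset.sum_le_sum fun n _ => ?_
  have hcard : (2 * (J : ℤ) + 1 - -(2 * J)).toNat = 4 * J + 1 := by omega
  refine (Finset.sum_le_sum_of_subset_of_nonneg (Finset.filter_subset _ _)
    fun m _ _ => by positivity).trans_eq ?_
  rw [Int.Icc_eq_finset_map, Finset.sum_map, hcard]
  rfl

theorem lyapunov_nonneg (w : ℤ → ℝ) (b : ℤ) (L : ℕ) : 0 ≤ lyapunov w b L :=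
  Finset.sum_nonneg fun t _ => by positivity

theorem lyapunov_le {w : ℤ → ℝ} {U : ℝ} (hw : ∀ m, |w m| ≤ U) (b : ℤ) (L : ℕ) :
    lyapunov w b L ≤ L * (5 * U ^ 2) := by
  refine (Finset.sum_le_card_nsmul _ _ (5 * U ^ 2) fun t _ => ?_).trans_eq (by simp)
  have hsq : w (b + t) ^ 2 ≤ U ^ 2 := sq_le_sq.2 ((hw _).trans (le_abs_self U))
  have hjump : |w (b + t + 2) - w (b + t)| ≤ 2 * U :=
    (abs_sub _ _).trans ((add_le_add (hw _) (hw _)).trans_eq (two_mul U).symm)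
  have hpos : (w (b + t + 2) - w (b + t))⁺ ^ 2 ≤ (2 * U) ^ 2 :=
    pow_le_pow_left₀ (posPart_nonneg _) ((posPart_le_abs _).trans hjump) 2
  linarith

theorem sum_range_le_of_add_le {Λ D : ℕ → ℝ} {A : ℝ} (h : ∀ n, Λ (n + 1) + D n ≤ Λ n + A)
    (N : ℕ) : ∑ n ∈ Finset.range N, D n ≤ Λ 0 - Λ N + N * A := by
  calc ∑ n ∈ Finset.range N, D n ≤ ∑ n ∈ Finset.range N, (Λ n - Λ (n + 1) + A) :=
        Finset.sum_le_sum fun n _ => by linarith [h n]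
    _ = Λ 0 - Λ N + N * A := by
        rw [Finset.sum_add_distrib, Finset.sum_range_sub', Finset.sum_const, Finset.card_range,
          nsmul_eq_mul]

theorem mul_floor_div_add_one_le {a d d₀ : ℝ} (ha : 0 ≤ a) (hd : 0 < d) (hdd₀ : d ≤ d₀) :
    d * (⌊a / d⌋₊ + 1 : ℕ) ≤ a + d₀ := by
  have := (le_div_iff₀' hd).1 (Nat.floor_le (div_nonneg ha hd.le))
  push_cast
  linarith

namespace UniformlyConvexFlux

variable {f : ℝ → ℝ → ℝ} {klo khi ulo uhi γ₁ γ₂ M L lam V : ℝ}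
  (hf : UniformlyConvexFlux f klo khi ulo uhi γ₁ γ₂ M L) (hlt : ulo < uhi) (hlam : 0 ≤ lam)
  (hcfl : lam * M ≤ γ₁ / (7500 * γ₂))

include hf hlt hlam hcfl

theorem exists_lyapunov_step_add_le (V : ℝ) : ∃ A, 0 ≤ A ∧ ∀ (K u : ℤ → ℝ) (n : ℕ),
    (∀ m, K m ∈ Set.Icc klo khi) → (∀ m, u m ∈ Set.Icc ulo uhi) →
    (∀ b : ℤ, ∑ t ∈ Finset.range n, |K (b + t + 2) - K (b + t)| ≤ V) → ∀ b : ℤ,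
      lyapunov (step f ulo uhi lam K u) b n
          + lam * γ₁ / 8 * ∑ t ∈ Finset.range n, |u (b + t + 2) - u (b + t)| ^ 3 ≤
        lyapunov u b n + A := by
  set U := boundC ulo uhi
  have hU : 0 ≤ U := boundC_nonneg ulo uhi
  set c := coeffLipschitzConst ulo uhi lam L
  have hc : 0 ≤ c := by
    have := sub_pos.2 hlt
    have := hf.lip_nonneg
    unfold c coeffLipschitzConst
    positivity
  refine ⟨|(1 + 6 * U + 36 * U ^ 2) * (c * V + c * V)
    + (85 * U ^ 2 + 4 * (lam * (2 * U * M * (uhi - ulo))))|, abs_nonneg _,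
    fun K u n hK hu hV b => ?_⟩
  obtain ⟨S, rfl, hSv, hSe⟩ := hf.exists_staggeredStep hlam hK hu hlt hcfl
  have he (b : ℤ) : ∑ t ∈ Finset.range n, S.e (b + t) ≤ c * V := by
    rw [hSe, ← Finset.mul_sum]
    exact mul_le_mul_of_nonneg_left (hV b) hc
  have herr : ∑ t ∈ Finset.range n, (S.e (b + t - 2) + S.e (b + t)) ≤ c * V + c * V := by
    rw [Finset.sum_add_distrib]
    refine add_le_add ?_ (he b)
    simpa only [sub_add_eq_add_sub] using he (b - 2)
  rw [← hSv]
  refine (S.lyapunov_new_le b n).trans ?_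
  rw [add_assoc]
  refine add_le_add_right (le_trans ?_ (le_abs_self _)) _
  gcongr

theorem exists_sum_cube_approx_le (V : ℝ) : ∃ A, 0 ≤ A ∧
    ∀ (k u₀ : ℝ → ℝ) (Δx : ℝ) (n : ℕ), (∀ m, cellAverage k Δx m ∈ Set.Icc klo khi) →
    (∀ m, cellAverage u₀ Δx m ∈ Set.Icc ulo uhi) →
    (∀ b : ℤ, ∑ t ∈ Finset.range n,
      |cellAverage k Δx (b + t + 2) - cellAverage k Δx (b + t)| ≤ V) → ∀ (b : ℤ) (N : ℕ),
      lam * γ₁ / 8 * ∑ i ∈ Finset.range N, ∑ t ∈ Finset.range n,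
        |approx f ulo uhi lam k u₀ Δx i (b + t + 2) - approx f ulo uhi lam k u₀ Δx i (b + t)| ^ 3 ≤
      n * (5 * boundC ulo uhi ^ 2) + N * A := by
  obtain ⟨A, hA, hstep⟩ := hf.exists_lyapunov_step_add_le hlt hlam hcfl V
  refine ⟨A, hA, fun k u₀ Δx n hK hu₀ hV b N => ?_⟩
  have hM : lam * M ≤ 1 / 4 := by linarith [hf.mul_M_le ⟨_, hK 0⟩ hlt hcfl]
  have hmem := hf.approx_mem hlam hM hK hu₀
  set w := approx f ulo uhi lam k u₀ Δx
  rw [Finset.mul_sum]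
  calc _ ≤ lyapunov (w 0) b n - lyapunov (w N) b n + N * A :=
        sum_range_le_of_add_le (Λ := fun i => lyapunov (w i) b n)
          (fun i => hstep _ (w i) n hK (hmem i) hV b) N
    _ ≤ n * (5 * boundC ulo uhi ^ 2) + N * A := by
        linarith [lyapunov_nonneg (w N) b n,
          lyapunov_le (fun m => abs_le_boundC (hmem 0 m)) b n]

end UniformlyConvexFlux

end

end CentralScheme

open CentralScheme in
theorem mainTheorem5_general
    (f : ℝ → ℝ → ℝ) (k u₀ : ℝ → ℝ) (klo khi ulo uhi γ₁ γ₂ M L lam : ℝ)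
    (hu : ulo < uhi)
    (hf : UniformlyConvexFlux f klo khi ulo uhi γ₁ γ₂ M L)
    (hk : MemLinftyBV k)
    (hk_range : ∀ᵐ x, k x ∈ Set.Icc klo khi)
    (hu₀ : AEStronglyMeasurable u₀)
    (hu₀_range : ∀ᵐ x, u₀ x ∈ Set.Icc ulo uhi)
    (hlam : 0 < lam)
    (hcfl : lam * M ≤ γ₁ / (7500 * γ₂))
    (T X Δx₀ : ℝ) (hT : 0 ≤ T) (hX : 0 ≤ X) :
    ∃ C : ℝ, ∀ Δx : ℝ, 0 < Δx → Δx ≤ Δx₀ →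
      Δx * cubicSum (approx f ulo uhi lam k u₀ Δx)
        (⌊T / (lam * Δx)⌋₊ + 1) (⌊X / Δx⌋₊ + 1) ≤ C := by
  obtain ⟨V, hV⟩ := hk.exists_sum_abs_cellAverage_sub_le
  obtain ⟨A, hA, hsum⟩ := hf.exists_sum_cube_approx_le hu hlam.le hcfl V
  set E := 5 * boundC ulo uhi ^ 2
  have hrate : 0 < lam * γ₁ / 8 := by
    have := hf.gamma_pos
    positivity
  refine ⟨((4 * (X + Δx₀) + Δx₀) * E + (T / lam + Δx₀) * A) / (lam * γ₁ / 8),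
    fun Δx hΔx hle => (le_div_iff₀' hrate).2 ?_⟩
  have hN := mul_floor_div_add_one_le (div_nonneg hT hlam.le) hΔx hle
  have hJ := mul_floor_div_add_one_le hX hΔx hle
  rw [div_div] at hN
  set N := ⌊T / (lam * Δx)⌋₊ + 1
  set J := ⌊X / Δx⌋₊ + 1
  calc _ = Δx * (lam * γ₁ / 8 * cubicSum (approx f ulo uhi lam k u₀ Δx) N J) := by ring
    _ ≤ Δx * ((4 * J + 1 : ℕ) * E + N * A) := by
        refine mul_le_mul_of_nonneg_left ?_ hΔx.le
        exact (mul_le_mul_of_nonneg_left (cubicSum_le _ N J) hrate.le).trans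
          (hsum k u₀ Δx _ (cellAverage_mem_Icc hk.1.aestronglyMeasurable hk_range hΔx)
            (cellAverage_mem_Icc hu₀ hu₀_range hΔx) (fun b => hV Δx hΔx b _) _ N)
    _ = (4 * (Δx * J) + Δx) * E + Δx * N * A := by
        push_cast
        ring
    _ ≤ (4 * (X + Δx₀) + Δx₀) * E + (T / lam + Δx₀) * A := by gcongr

theorem mainTheorem5
    (f : ℝ → ℝ → ℝ) (k u₀ : ℝ → ℝ) (klo khi ulo uhi γ₁ γ₂ lam κ : ℝ)
    (hu : ulo < uhi)
    (hf : CentralScheme.FluxHypotheses f klo khi ulo uhi γ₁ γ₂)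
    (hk : CentralScheme.MemLinftyBV k)
    (hk_range : ∀ᵐ x ∂(MeasureTheory.volume : MeasureTheory.Measure ℝ), k x ∈ Set.Icc klo khi)
    (hu₀ : CentralScheme.MemLinftyBV u₀)
    (hu₀_range : ∀ᵐ x ∂(MeasureTheory.volume : MeasureTheory.Measure ℝ), u₀ x ∈ Set.Icc ulo uhi)
    (hlam : 0 < lam)
    (hcfl : CentralScheme.CFL f klo khi ulo uhi γ₁ γ₂ lam κ)
    (T X Δx₀ : ℝ) (hT : 0 < T) (hX : 0 < X) (hΔx₀ : 0 < Δx₀) :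
    ∃ C : ℝ, ∀ Δx : ℝ, 0 < Δx → Δx ≤ Δx₀ →
      Δx * CentralScheme.cubicSum (CentralScheme.approx f ulo uhi lam k u₀ Δx)
        (⌊T / (lam * Δx)⌋₊ + 1) (⌊X / Δx⌋₊ + 1) ≤ C := by
  obtain ⟨x, hx⟩ := hk_range.exists
  have hM : ∀ k ∈ Set.Icc klo khi, ∀ u ∈ Set.Icc ulo uhi,
      |CentralScheme.fluxDu f ulo uhi k u| ≤ κ / lam := fun k hk u hu =>
    (le_div_iff₀' hlam).2 (hcfl.1 k hk u hu)
  exact mainTheorem5_general f k u₀ klo khi ulo uhi γ₁ γ₂ _ _ lam hu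
    (hf.uniformlyConvexFlux hu (hx.1.trans hx.2) hM) hk hk_range hu₀.1.aestronglyMeasurable
    hu₀_range hlam ((mul_div_cancel₀ κ hlam.ne').trans_le
      (hcfl.2.trans ((min_le_left _ _).trans (min_le_left _ _)))) T X Δx₀ hT.le hX.le
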